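/- Let $G$ be a discrete group, $R$ a commutative ring with identity, and $\mathcal G$ an ample Hausdorff groupoid (an étale topological groupoid with a basis of compact open bisections) with domain map $d$, range map $r$ and unit space $\mathcal G^{(0)}$, graded by a continuous $1$-cocycle $c:\mathcal G\to G$; put $\mathcal G_g=c^{-1}(g)$. The Steinberg algebra $A_R(\mathcal G)$ is the $R$-module of locally constant compactly supported functions $\mathcal G\to R$ with the convolution product $(f*f')(\gamma)=\sum_{\alpha\beta=\gamma}f(\alpha)f'(\beta)$, and its component of degree $g$ consists of the functions supported in $\mathcal G_g$. Let $\mathcal G^{(h)}$ be the inverse semigroup of all compact open bisections $B$ of $\mathcal G$ that are contained in some $\mathcal G_g$, with $BC=\{\beta\gamma:\beta\in B,\ \gamma\in C,\ d(\beta)=r(\gamma)\}$ and $B^*=B^{-1}$; a nonempty $B\subseteq\mathcal G_g$ has degree $g$. Let $U\subseteq\mathcal G^{(0)}$ be an open invariant subset, that is, $d(\gamma)\in U$ implies $r(\gamma)\in U$, and let $\mathcal G_U=d^{-1}(U)$, an open subgroupoid of $\mathcal G$, graded by the restriction of $c$. For $B\in\mathcal G^{(h)}$ let $U_B=r(B)\cap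 U$ and let $\pi_B:U_{B^{-1}}=d(B)\cap U\to U_B$ be the homeomorphism $d(b)\mapsto r(b)$, $b\in B$. Let $C_R(U)$ be the algebra of locally constant compactly supported functions $U\to R$ with pointwise operations, and regard $C_R(U_B)$ as an ideal of $C_R(U)$ through extension by zero. The maps $\pi_B:C_R(U_{B^{-1}})\to C_R(U_B)$, $f\mapsto f\circ\pi_B^{-1}$, form a partial action $\pi$ of $\mathcal G^{(h)}$ on $C_R(U)$. Let $\mathcal L$ be the algebra of finite formal sums $\sum_B a_B\delta_B$ with $B\in\mathcal G^{(h)}$ and $a_B\in C_R(U_B)$, with the product determined by $(a\delta_B)(b\delta_C)=\pi_B(\pi_{B^{-1}}(a)\,b)\,\delta_{BC}$, and let $\mathcal N$ be the two-sided ideal of $\mathcal L$ generated by the elements $a\delta_B-a\delta_C$ with $B\le C$ (the natural partial order of $\mathcal G^{(h)}$, $B=CB^{-1}B$) and $a\in C_R(U_B)$. The partial skew inverse semigroup ring is $C_R(U)\rtimes_\pi\mathcal G^{(h)}=\mathcal L/\mathcal N$; its component of degree $g$ is spanned by the classes of the elements $a\delta_B$ with $B$ nonempty of degree $g$ and $a\in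 C_R(U_B)$. Then $A_R(\mathcal G_U)$ and $C_R(U)\rtimes_\pi\mathcal G^{(h)}$ are $G$-graded algebras, and there is a $G$-graded isomorphism of $R$-algebras $$A_R(\mathcal G_U)\cong_{\mathrm{gr}}C_R(U)\rtimes_\pi\mathcal G^{(h)}.$$ In particular, $A_R(\mathcal G)\cong_{\mathrm{gr}}C_R(\mathcal G^{(0)})\rtimes_\pi\mathcal G^{(h)}$. -/

import Mathlib

open Set Topology

/-! ### Groupoids, described by their arrows -/

/-- A groupoid: a small category all of whose morphisms are invertible, presented by its set `Γ` of
arrows. Objects are identified with their identity arrows, `dom x` and `rng x` are the (units at the)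
domain and range of `x`, and `x y` is defined precisely when `dom x = rng y`. -/
class ArrowGroupoid (Γ : Type*) where
  dom : Γ → Γ
  rng : Γ → Γ
  inv : Γ → Γ
  comp : ∀ x y : Γ, dom x = rng y → Γ
  dom_dom : ∀ x, dom (dom x) = dom x
  rng_dom : ∀ x, rng (dom x) = dom x
  dom_rng : ∀ x, dom (rng x) = rng x
  rng_rng : ∀ x, rng (rng x) = rng x
  dom_comp : ∀ x y h, dom (comp x y h) = dom y
  rng_comp : ∀ x y h, rng (comp x y h) = rng x
  comp_dom : ∀ x, comp x (dom x) (rng_dom x).symm = x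
  comp_rng : ∀ x, comp (rng x) x (dom_rng x) = x
  assoc : ∀ x y z (hxy : dom x = rng y) (hyz : dom y = rng z),
    comp (comp x y hxy) z ((dom_comp x y hxy).trans hyz) =
      comp x (comp y z hyz) (hxy.trans (rng_comp y z hyz).symm)
  dom_inv : ∀ x, dom (inv x) = rng x
  rng_inv : ∀ x, rng (inv x) = dom x
  inv_comp : ∀ x, comp (inv x) x (dom_inv x) = dom x
  comp_inv : ∀ x, comp x (inv x) (rng_inv x).symm = rng x

namespace ArrowGroupoid

attribute [simp] dom_dom rng_dom dom_rng rng_rng dom_comp rng_comp comp_dom comp_rng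
  dom_inv rng_inv inv_comp comp_inv

section
variable {Γ : Type*} [ArrowGroupoid Γ]

variable (Γ) in
/-- The unit space. -/
def unitSpace : Set Γ := range (dom : Γ → Γ)

theorem mem_unitSpace_iff {x : Γ} : x ∈ unitSpace Γ ↔ dom x = x :=
  ⟨fun ⟨y, hy⟩ => by rw [← hy]; simp, fun h => ⟨x, h⟩⟩

theorem rng_of_mem_unitSpace {x : Γ} (h : x ∈ unitSpace Γ) : rng x = x := by
  obtain ⟨y, rfl⟩ := h; simp

theorem dom_mem (x : Γ) : dom x ∈ unitSpace Γ := ⟨x, rfl⟩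
theorem rng_mem (x : Γ) : rng x ∈ unitSpace Γ := ⟨rng x, dom_rng x⟩

/-- The domain map, as a map to the unit space. -/
def domU (x : Γ) : unitSpace Γ := ⟨dom x, dom_mem x⟩
/-- The range map, as a map to the unit space. -/
def rngU (x : Γ) : unitSpace Γ := ⟨rng x, rng_mem x⟩

theorem comp_congr {x x' y y' : Γ} (hx : x = x') (hy : y = y') (h : dom x = rng y) :
    comp x y h = comp x' y' (hx ▸ hy ▸ h) := by subst hx hy; rfl

theorem inv_comp_cancel {x y : Γ} (h : dom x = rng y) :
    comp (inv x) (comp x y h) (by simp) = y := by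
  rw [← assoc (inv x) x y (by simp) h, comp_congr (inv_comp x) rfl,
    comp_congr h rfl]
  simp

theorem comp_inv_cancel {x y : Γ} (h : rng x = rng y) :
    comp x (comp (inv x) y (by simpa using h)) (by simp) = y := by
  rw [← assoc x (inv x) y (by simp) (by simpa using h), comp_congr (comp_inv x) rfl,
    comp_congr h rfl]
  simp

theorem eq_inv_of_comp {x y : Γ} (h : dom x = rng y) (e : comp x y h = rng x) : y = inv x := by
  rw [← inv_comp_cancel h, comp_congr rfl e, comp_congr rfl (dom_inv x).symm, comp_dom]

theorem inv_inv (x : Γ) : inv (inv x) = x :=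
  (eq_inv_of_comp (dom_inv x) (by simp)).symm

theorem inv_of_unit {x : Γ} (h : x ∈ unitSpace Γ) : inv x = x := by
  obtain ⟨y, rfl⟩ := h
  refine (eq_inv_of_comp (by simp) ?_).symm
  rw [comp_congr rfl (dom_dom y).symm, comp_dom]; simp

theorem eq_unit_of_comp_self {x : Γ} (h : dom x = rng x) (e : comp x x h = x) :
    x ∈ unitSpace Γ := by
  have := inv_comp_cancel h
  rw [comp_congr rfl e, inv_comp] at this
  exact ⟨x, this⟩

/-- The product `B C` of two sets of arrows. -/
def setMul (B C : Set Γ) : Set Γ := {x | ∃ b ∈ B, ∃ c ∈ C, ∃ h : dom b = rng c, comp b c h = x}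

/-- The inverse of a set of arrows. -/
def setInv (B : Set Γ) : Set Γ := inv '' B

theorem mem_setInv {B : Set Γ} {x : Γ} : x ∈ setInv B ↔ inv x ∈ B :=
  ⟨fun ⟨y, hy, e⟩ => by rw [← e, inv_inv]; exact hy, fun h => ⟨_, h, inv_inv x⟩⟩

theorem setMul_assoc (B C D : Set Γ) : setMul (setMul B C) D = setMul B (setMul C D) := by
  ext x
  constructor
  · rintro ⟨_, ⟨b, hb, c, hc, h, rfl⟩, d, hd, h', rfl⟩
    have h'' : dom c = rng d := by simpa using h'
    exact ⟨b, hb, _, ⟨c, hc, d, hd, h'', rfl⟩, by simpa using h, (assoc b c d h h'').symm⟩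
  · rintro ⟨b, hb, _, ⟨c, hc, d, hd, h, rfl⟩, h', rfl⟩
    have h'' : dom b = rng c := by simpa using h'
    exact ⟨_, ⟨b, hb, c, hc, h'', rfl⟩, d, hd, by simpa using h, assoc b c d h'' h⟩

/-- A subset `B` is an open bisection when it is open and both `d|_B` and `r|_B` are
homeomorphisms onto open subsets of the unit space. -/
structure IsOpenBisection [TopologicalSpace Γ] (B : Set Γ) : Prop where
  isOpen : IsOpen B
  dom_embedding : IsOpenEmbedding (fun x : B => domU (x : Γ))
  rng_embedding : IsOpenEmbedding (fun x : B => rngU (x : Γ))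

end
end ArrowGroupoid

open ArrowGroupoid

/-! ### Topological, étale and ample groupoids -/

/-- Topological groupoid: inversion and composition (on composable pairs) are continuous. -/
class TopologicalGroupoid (Γ : Type*) [TopologicalSpace Γ] [ArrowGroupoid Γ] : Prop where
  continuous_inv : Continuous (inv : Γ → Γ)
  continuous_comp :
    Continuous (fun p : {p : Γ × Γ // dom p.1 = rng p.2} => comp p.1.1 p.1.2 p.2)

/-- Étale groupoid: the domain map onto the unit space is a local homeomorphism. -/
class EtaleGroupoid (Γ : Type*) [TopologicalSpace Γ] [ArrowGroupoid Γ] : Prop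
    extends TopologicalGroupoid Γ where
  isLocalHomeomorph_domU : IsLocalHomeomorph (domU : Γ → unitSpace Γ)

/-- Ample groupoid: the compact open bisections form a basis of the topology. -/
class AmpleGroupoid (Γ : Type*) [TopologicalSpace Γ] [ArrowGroupoid Γ] : Prop
    extends EtaleGroupoid Γ where
  isBasis : TopologicalSpace.IsTopologicalBasis {B : Set Γ | IsCompact B ∧ IsOpenBisection B}

namespace ArrowGroupoid
section
variable {Γ : Type*} [TopologicalSpace Γ] [ArrowGroupoid Γ]

theorem continuous_dom [EtaleGroupoid Γ] : Continuous (dom : Γ → Γ) :=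
  continuous_subtype_val.comp (EtaleGroupoid.isLocalHomeomorph_domU (Γ := Γ)).continuous

/-- Inversion as a homeomorphism. -/
def invHomeo [TopologicalGroupoid Γ] : Γ ≃ₜ Γ where
  toFun := inv
  invFun := inv
  left_inv := inv_inv
  right_inv := inv_inv
  continuous_toFun := TopologicalGroupoid.continuous_inv
  continuous_invFun := TopologicalGroupoid.continuous_inv

theorem continuous_rng [EtaleGroupoid Γ] : Continuous (rng : Γ → Γ) := by
  have : (rng : Γ → Γ) = dom ∘ inv := by ext x; simp
  rw [this]
  exact continuous_dom.comp TopologicalGroupoid.continuous_inv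

theorem isLocalHomeomorph_rngU [EtaleGroupoid Γ] : IsLocalHomeomorph (rngU : Γ → unitSpace Γ) := by
  have : (rngU : Γ → unitSpace Γ) = domU ∘ (invHomeo : Γ ≃ₜ Γ) := by
    ext x; simp [rngU, domU, invHomeo]
  rw [this]
  exact EtaleGroupoid.isLocalHomeomorph_domU.comp invHomeo.isLocalHomeomorph

/-- The unit space of an étale groupoid is open. -/
theorem isOpen_unitSpace [EtaleGroupoid Γ] : IsOpen (unitSpace Γ) := by
  rw [isOpen_iff_mem_nhds]
  intro u hu
  obtain ⟨e, hue, he⟩ := (EtaleGroupoid.isLocalHomeomorph_domU (Γ := Γ)) u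
  have hV : e.source ∈ 𝓝 u := e.open_source.mem_nhds hue
  have hV' : dom ⁻¹' e.source ∈ 𝓝 u := by
    apply continuous_dom.continuousAt.preimage_mem_nhds
    rwa [mem_unitSpace_iff.1 hu]
  filter_upwards [hV, hV'] with x hx hx'
  refine ⟨x, e.injOn hx' hx ?_⟩
  rw [← he]
  exact Subtype.ext (dom_dom x)

theorem isOpenBisection_iff [EtaleGroupoid Γ] {B : Set Γ} :
    IsOpenBisection B ↔ IsOpen B ∧ InjOn dom B ∧ InjOn rng B := by
  constructor
  · rintro ⟨h1, h2, h3⟩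
    refine ⟨h1, fun x hx y hy e => ?_, fun x hx y hy e => ?_⟩
    · exact congrArg Subtype.val (h2.injective (a₁ := ⟨x, hx⟩) (a₂ := ⟨y, hy⟩) (Subtype.ext e))
    · exact congrArg Subtype.val (h3.injective (a₁ := ⟨x, hx⟩) (a₂ := ⟨y, hy⟩) (Subtype.ext e))
  · rintro ⟨h1, h2, h3⟩
    refine ⟨h1, ?_, ?_⟩
    · refine IsLocalHomeomorph.isOpenEmbedding_of_injective
        (EtaleGroupoid.isLocalHomeomorph_domU.comp h1.isOpenEmbedding_subtypeVal.isLocalHomeomorph)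
        fun x y e => Subtype.ext (h2 x.2 y.2 (congrArg Subtype.val e))
    · refine IsLocalHomeomorph.isOpenEmbedding_of_injective
        (isLocalHomeomorph_rngU.comp h1.isOpenEmbedding_subtypeVal.isLocalHomeomorph)
        fun x y e => Subtype.ext (h3 x.2 y.2 (congrArg Subtype.val e))

theorem isOpenMap_rng [EtaleGroupoid Γ] : IsOpenMap (rng : Γ → Γ) :=
  isOpen_unitSpace.isOpenMap_subtype_val.comp isLocalHomeomorph_rngU.isOpenMap

theorem IsOpenBisection.exists_section [EtaleGroupoid Γ] {B : Set Γ} (hB : IsOpenBisection B) :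
    ∃ σ : rng '' B → Γ, Continuous σ ∧ (∀ u, σ u ∈ B) ∧ ∀ u, rng (σ u) = u := by
  let e := hB.rng_embedding.toIsEmbedding.toHomeomorph
  have hmem : ∀ u : rng '' B, (⟨u.1, by obtain ⟨b, -, h⟩ := u.2; rw [← h]; exact rng_mem b⟩ :
      unitSpace Γ) ∈ range (fun x : B => rngU (x : Γ)) := by
    rintro ⟨_, b, hb, rfl⟩
    exact ⟨⟨b, hb⟩, rfl⟩
  refine ⟨fun u => (e.symm ⟨_, hmem u⟩ : B), ?_, fun u => Subtype.coe_prop _, fun u => ?_⟩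
  · exact continuous_subtype_val.comp (e.symm.continuous.comp (by fun_prop))
  · have := e.apply_symm_apply ⟨_, hmem u⟩
    exact congrArg (fun z => ((z : unitSpace Γ) : Γ)) (congrArg Subtype.val this)

/-- For an open bisection `B`, left division `y ↦ b⁻¹ y`, `b ∈ B`, `r(b) = r(y)`, is continuous. -/
theorem continuous_leftDiv [EtaleGroupoid Γ] {S T : Set Γ} (σ : T → Γ) (hσ : Continuous σ)
    (hr : ∀ u, rng (σ u) = u) (hS : ∀ y ∈ S, rng y ∈ T) :
    Continuous (fun y : S => comp (inv (σ ⟨rng y.1, hS _ y.2⟩)) y.1 (by simp [hr])) := by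
  have h1 : Continuous (fun y : S => (⟨(inv (σ ⟨rng y.1, hS _ y.2⟩), y.1), by simp [hr]⟩ :
      {p : Γ × Γ // dom p.1 = rng p.2})) := by
    refine Continuous.subtype_mk (Continuous.prodMk ?_ continuous_subtype_val) _
    exact TopologicalGroupoid.continuous_inv.comp (hσ.comp
      ((continuous_rng.comp continuous_subtype_val).subtype_mk _))
  exact TopologicalGroupoid.continuous_comp.comp h1

theorem IsOpenBisection.mul [EtaleGroupoid Γ] {B C : Set Γ} (hB : IsOpenBisection B)
    (hC : IsOpenBisection C) : IsOpenBisection (setMul B C) := by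
  obtain ⟨oB, dB, rB⟩ := isOpenBisection_iff.1 hB
  obtain ⟨oC, dC, rC⟩ := isOpenBisection_iff.1 hC
  refine isOpenBisection_iff.2 ⟨?_, ?_, ?_⟩
  · obtain ⟨σ, hσ, hm, hr⟩ := hB.exists_section
    have hcont := continuous_leftDiv (S := rng ⁻¹' (rng '' B)) σ hσ hr (fun y hy => hy)
    have hS : IsOpen (rng ⁻¹' (rng '' B) : Set Γ) :=
      (isOpenMap_rng _ oB).preimage continuous_rng
    have := hS.isOpenMap_subtype_val _ (oC.preimage hcont)
    convert this using 1
    ext x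
    constructor
    · rintro ⟨b, hb, c, hc, h, rfl⟩
      have hx : rng (comp b c h) ∈ rng '' B := ⟨b, hb, by simp⟩
      refine ⟨⟨_, hx⟩, ?_, rfl⟩
      have : σ ⟨_, hx⟩ = b := rB (hm _) hb (by simp [hr])
      change comp _ _ _ ∈ C
      rw [comp_congr (congrArg inv this) rfl, inv_comp_cancel h]
      exact hc
    · rintro ⟨⟨y, hy⟩, h, rfl⟩
      exact ⟨σ ⟨rng y, hy⟩, hm _, _, h, by simp, comp_inv_cancel (by simp [hr])⟩
  · rintro _ ⟨b, hb, c, hc, h, rfl⟩ _ ⟨b', hb', c', hc', h', rfl⟩ e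
    have e1 : c = c' := dC hc hc' (by simpa using e)
    subst e1
    have e2 : b = b' := dB hb hb' (h.trans h'.symm)
    subst e2
    rfl
  · rintro _ ⟨b, hb, c, hc, h, rfl⟩ _ ⟨b', hb', c', hc', h', rfl⟩ e
    have e1 : b = b' := rB hb hb' (by simpa using e)
    subst e1
    have e2 : c = c' := rC hc hc' (h.symm.trans h')
    subst e2
    rfl

theorem isCompact_setMul [EtaleGroupoid Γ] [T2Space Γ] {B C : Set Γ} (hB : IsCompact B)
    (hC : IsCompact C) : IsCompact (setMul B C) := by
  have hcl : IsClosed {p : Γ × Γ | dom p.1 = rng p.2} :=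
    isClosed_eq (continuous_dom.comp continuous_fst) (continuous_rng.comp continuous_snd)
  have h1 : IsCompact ((Subtype.val : {p : Γ × Γ // dom p.1 = rng p.2} → Γ × Γ) ⁻¹' (B ×ˢ C)) :=
    hcl.isClosedEmbedding_subtypeVal.isCompact_preimage (hB.prod hC)
  convert h1.image TopologicalGroupoid.continuous_comp using 1
  ext x
  constructor
  · rintro ⟨b, hb, c, hc, h, rfl⟩
    exact ⟨⟨(b, c), h⟩, ⟨hb, hc⟩, rfl⟩
  · rintro ⟨⟨⟨b, c⟩, h⟩, ⟨hb, hc⟩, rfl⟩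
    exact ⟨b, hb, c, hc, h, rfl⟩

theorem IsOpenBisection.inv [EtaleGroupoid Γ] {B : Set Γ} (hB : IsOpenBisection B) :
    IsOpenBisection (setInv B) := by
  obtain ⟨oB, dB, rB⟩ := isOpenBisection_iff.1 hB
  refine isOpenBisection_iff.2 ⟨invHomeo.isOpenMap _ oB, ?_, ?_⟩
  · rintro _ ⟨b, hb, rfl⟩ _ ⟨b', hb', rfl⟩ e
    rw [rB hb hb' (by simpa using e)]
  · rintro _ ⟨b, hb, rfl⟩ _ ⟨b', hb', rfl⟩ e
    rw [dB hb hb' (by simpa using e)]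

theorem isCompact_setInv [EtaleGroupoid Γ] {B : Set Γ} (hB : IsCompact B) :
    IsCompact (setInv B) :=
  hB.image TopologicalGroupoid.continuous_inv

end
end ArrowGroupoid

/-! ### Locally constant functions with compact support -/

/-- `C_R(X)`: the functions `X → R` that are continuous for the discrete topology on `R` (that is,
locally constant) and have compact support, with pointwise operations. -/
def CcR (R X : Type*) [CommRing R] [TopologicalSpace X] :
    NonUnitalSubalgebra R (X → R) where
  carrier := {f | IsLocallyConstant f ∧ IsCompact (Function.support f)}
  zero_mem' := ⟨IsLocallyConstant.const 0, by simp⟩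
  add_mem' := by
    rintro f g ⟨hf, hf'⟩ ⟨hg, hg'⟩
    refine ⟨hf.add hg, (hf'.union hg').of_isClosed_subset ?_ (Function.support_add f g)⟩
    exact ((hf.add hg).isClopen_fiber 0).compl.isClosed
  mul_mem' := by
    rintro f g ⟨hf, hf'⟩ ⟨hg, hg'⟩
    refine ⟨hf.mul hg, hf'.of_isClosed_subset ((hf.mul hg).isClopen_fiber 0).compl.isClosed ?_⟩
    exact Function.support_mul_subset_left f g
  smul_mem' := by
    rintro r f ⟨hf, hf'⟩
    have h : IsLocallyConstant (r • f) := hf.comp (fun a => r * a)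
    refine ⟨h, hf'.of_isClosed_subset (h.isClopen_fiber 0).compl.isClosed ?_⟩
    exact Function.support_const_smul_subset r f

/-- Extending a locally constant function by zero outside a clopen set. -/
theorem IsLocallyConstant.dite_zero {R X : Type*} [Zero R] [TopologicalSpace X] {S : Set X}
    (hS : IsClopen S) [DecidablePred (· ∈ S)] {F : S → R} (hF : IsLocallyConstant F) :
    IsLocallyConstant (fun x => if h : x ∈ S then F ⟨x, h⟩ else 0) := by
  rw [IsLocallyConstant.iff_exists_open]
  intro x
  by_cases hx : x ∈ S
  · obtain ⟨W, hW, hxW, hc⟩ := (IsLocallyConstant.iff_exists_open F).1 hF ⟨x, hx⟩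
    refine ⟨Subtype.val '' W, hS.isOpen.isOpenMap_subtype_val _ hW, ⟨_, hxW, rfl⟩, ?_⟩
    rintro _ ⟨y, hy, rfl⟩
    simp only [hx, y.2, dif_pos]
    exact hc y hy
  · refine ⟨Sᶜ, hS.compl.isOpen, hx, fun y hy => ?_⟩
    rw [dif_neg hx, dif_neg hy]

section Support
variable {R X : Type*} [CommRing R] [TopologicalSpace X]

theorem IsLocallyConstant.isClosed_support {f : X → R} (hf : IsLocallyConstant f) :
    IsClosed (Function.support f) :=
  (hf.isClopen_fiber 0).compl.isClosed

end Support

/-! ### Steinberg algebras -/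

section Convolution
variable {R Γ : Type*} [CommRing R] [ArrowGroupoid Γ]

/-- Convolution, `(f * g)(γ) = ∑_{αβ = γ} f(α) g(β)`. For `f`, `g` locally constant with compact
support on an ample Hausdorff groupoid the sum has only finitely many nonzero terms. -/
noncomputable def convolution (f g : Γ → R) (γ : Γ) : R :=
  ∑ᶠ p : {p : Γ × Γ // ∃ h : dom p.1 = rng p.2, comp p.1 p.2 h = γ}, f p.1.1 * g p.1.2

theorem factorization_ext {γ : Γ}
    {p q : {p : Γ × Γ // ∃ h : dom p.1 = rng p.2, comp p.1 p.2 h = γ}}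
    (h : p.1.1 = q.1.1) : p = q := by
  obtain ⟨⟨a, b⟩, hab, e⟩ := p
  obtain ⟨⟨a', b'⟩, hab', e'⟩ := q
  dsimp only at h hab hab' e e'
  subst h
  have : b = b' := by
    rw [← inv_comp_cancel hab, ← inv_comp_cancel hab', comp_congr rfl (e.trans e'.symm)]
  subst this
  rfl

theorem finite_fiber [TopologicalSpace Γ] [T2Space Γ] [EtaleGroupoid Γ] {K : Set Γ}
    (hK : IsCompact K) (u : Γ) : {a ∈ K | rng a = u}.Finite := by
  have hcl : IsClosed {a : Γ | rng a = u} := isClosed_eq continuous_rng continuous_const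
  have hc : IsCompact (K ∩ {a : Γ | rng a = u}) := hK.inter_right hcl
  refine hc.finite (isDiscrete_iff_forall_mem_exists_isOpen.2 fun x hx => ?_)
  obtain ⟨e, hue, he⟩ := (isLocalHomeomorph_rngU (Γ := Γ)) x
  refine ⟨e.source, e.open_source, ?_⟩
  ext y
  constructor
  · rintro ⟨hy, -, hy'⟩
    refine e.injOn hy hue ?_
    rw [← he]
    exact Subtype.ext (hy'.trans hx.2.symm)
  · rintro rfl
    exact ⟨hue, hx⟩

theorem convolution_zero_left (g : Γ → R) : convolution (0 : Γ → R) g = 0 := by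
  ext γ; simp [convolution]

theorem convolution_zero_right (f : Γ → R) : convolution f (0 : Γ → R) = 0 := by
  ext γ; simp [convolution]

variable [TopologicalSpace Γ] [T2Space Γ]

theorem finite_support_convolution [EtaleGroupoid Γ] {f : Γ → R}
    (hf : IsCompact (Function.support f)) (g : Γ → R) (γ : Γ) :
    (Function.support (fun p : {p : Γ × Γ // ∃ h : dom p.1 = rng p.2, comp p.1 p.2 h = γ} =>
      f p.1.1 * g p.1.2)).Finite := by
  refine Set.Finite.of_finite_image (f := fun p => p.1.1)
    ((finite_fiber hf (rng γ)).subset ?_) (fun p _ q _ h => factorization_ext h)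
  rintro _ ⟨⟨⟨a, b⟩, h, rfl⟩, hp, rfl⟩
  exact ⟨left_ne_zero_of_mul hp, by simp⟩

theorem convolution_add_left [EtaleGroupoid Γ] {f f' : Γ → R}
    (hf : IsCompact (Function.support f)) (hf' : IsCompact (Function.support f')) (g : Γ → R) :
    convolution (f + f') g = convolution f g + convolution f' g := by
  ext γ
  simp only [convolution, Pi.add_apply, add_mul]
  exact finsum_add_distrib (finite_support_convolution hf g γ) (finite_support_convolution hf' g γ)

theorem convolution_add_right [EtaleGroupoid Γ] {f : Γ → R}
    (hf : IsCompact (Function.support f)) (g g' : Γ → R) :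
    convolution f (g + g') = convolution f g + convolution f g' := by
  ext γ
  simp only [convolution, Pi.add_apply, mul_add]
  exact finsum_add_distrib (finite_support_convolution hf g γ) (finite_support_convolution hf g' γ)

theorem convolution_smul_left [EtaleGroupoid Γ] {f : Γ → R}
    (hf : IsCompact (Function.support f)) (r : R) (g : Γ → R) :
    convolution (r • f) g = r • convolution f g := by
  ext γ
  simp only [convolution, Pi.smul_apply, smul_mul_assoc]
  exact (smul_finsum' r (finite_support_convolution hf g γ)).symm

theorem convolution_smul_right [EtaleGroupoid Γ] {f : Γ → R}
    (hf : IsCompact (Function.support f)) (r : R) (g : Γ → R) :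
    convolution f (r • g) = r • convolution f g := by
  ext γ
  simp only [convolution, Pi.smul_apply, mul_smul_comm]
  exact (smul_finsum' r (finite_support_convolution hf g γ)).symm

open Classical in
/-- The convolution with a function supported in an open bisection. -/
theorem convolution_of_section [EtaleGroupoid Γ] {B : Set Γ} (hB : IsOpenBisection B)
    {σ : rng '' B → Γ} (hm : ∀ u, σ u ∈ B) (hr : ∀ u, rng (σ u) = u)
    {f : Γ → R} (hf : Function.support f ⊆ B) (g : Γ → R) (γ : Γ) :
    convolution f g γ = if h : rng γ ∈ rng '' B then
      f (σ ⟨rng γ, h⟩) * g (comp (inv (σ ⟨rng γ, h⟩)) γ (by simp [hr])) else 0 := by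
  split_ifs with h
  · rw [convolution, finsum_eq_single _ ⟨(σ ⟨rng γ, h⟩, comp (inv (σ ⟨rng γ, h⟩)) γ
      (by simp [hr])), by simp, comp_inv_cancel (by simp [hr])⟩]
    rintro ⟨⟨a, b⟩, hab, e⟩ hne
    dsimp only at hab e ⊢
    by_contra hz
    apply hne
    apply factorization_ext
    refine (isOpenBisection_iff.1 hB).2.2 (hf (left_ne_zero_of_mul hz)) (hm _) ?_
    rw [hr]; simp [← e]
  · rw [convolution]
    convert finsum_zero
    rename_i p
    obtain ⟨⟨a, b⟩, hab, e⟩ := p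
    dsimp only at hab e ⊢
    by_contra hz
    exact h ⟨a, hf (left_ne_zero_of_mul hz), by rw [← e]; simp⟩

theorem isLocallyConstant_convolution_of_bisection [EtaleGroupoid Γ] {B : Set Γ}
    (hB : IsOpenBisection B) (hBc : IsCompact B) {f g : Γ → R} (hf : IsLocallyConstant f)
    (hfB : Function.support f ⊆ B) (hg : IsLocallyConstant g) :
    IsLocallyConstant (convolution f g) := by
  classical
  obtain ⟨σ, hσ, hm, hr⟩ := hB.exists_section
  have hS : IsClopen (rng ⁻¹' (rng '' B) : Set Γ) :=
    ⟨(hBc.image continuous_rng).isClosed.preimage continuous_rng,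
      (isOpenMap_rng _ hB.isOpen).preimage continuous_rng⟩
  have h1 : Continuous (fun y : (rng ⁻¹' (rng '' B) : Set Γ) => σ ⟨rng y.1, y.2⟩) :=
    hσ.comp ((continuous_rng.comp continuous_subtype_val).subtype_mk _)
  have h2 := continuous_leftDiv (S := rng ⁻¹' (rng '' B)) σ hσ hr (fun y hy => hy)
  have := IsLocallyConstant.dite_zero hS ((hf.comp_continuous h1).mul (hg.comp_continuous h2))
  convert this using 1
  ext γ
  rw [convolution_of_section hB hm hr hfB]
  rfl

theorem isLocallyConstant_convolution [AmpleGroupoid Γ] {f g : Γ → R} (hf : IsLocallyConstant f)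
    (hfc : IsCompact (Function.support f)) (hg : IsLocallyConstant g) :
    IsLocallyConstant (convolution f g) := by
  classical
  -- cover the support of `f` by finitely many compact open bisections, then peel them off
  have key : ∀ t : Finset {B : Set Γ // IsCompact B ∧ IsOpenBisection B}, ∀ f : Γ → R,
      IsLocallyConstant f → IsCompact (Function.support f) →
      Function.support f ⊆ ⋃ B ∈ t, B.1 → IsLocallyConstant (convolution f g) := by
    intro t
    induction t using Finset.induction_on with
    | empty =>
      intro f _ _ h
      have : f = 0 := by
        rw [← Function.support_eq_empty_iff]
        simpa using h
      rw [this, convolution_zero_left]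
      exact IsLocallyConstant.const 0
    | insert B t _ ih =>
      intro f hf hfc h
      have hBcl : IsClopen B.1 := ⟨B.2.1.isClosed, B.2.2.isOpen⟩
      have hadd : f = B.1.indicator f + (B.1)ᶜ.indicator f :=
        (Set.indicator_self_add_compl B.1 f).symm
      have l1 : IsLocallyConstant (B.1.indicator f) := by
        have := IsLocallyConstant.dite_zero hBcl (hf.comp_continuous continuous_subtype_val)
        convert this using 1
        ext x
        simp [Set.indicator_apply]
      have l2 : IsLocallyConstant ((B.1)ᶜ.indicator f) := by
        have := IsLocallyConstant.dite_zero hBcl.compl (hf.comp_continuous continuous_subtype_val)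
        convert this using 1
        ext x
        simp [Set.indicator_apply]
      have s1 : Function.support (B.1.indicator f) ⊆ Function.support f := by simp
      have s2 : Function.support ((B.1)ᶜ.indicator f) ⊆ Function.support f := by simp
      have c1 := hfc.of_isClosed_subset l1.isClosed_support s1
      have c2 := hfc.of_isClosed_subset l2.isClosed_support s2
      rw [hadd, convolution_add_left c1 c2]
      refine (isLocallyConstant_convolution_of_bisection B.2.2 B.2.1 l1 (by simp) hg).add
        (ih _ l2 c2 ?_)
      intro x hx
      have hx1 := h (s2 hx)
      rw [Finset.set_biUnion_insert] at hx1
      refine hx1.resolve_left fun hxB => ?_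
      simp [hxB] at hx
  obtain ⟨t, ht⟩ := hfc.elim_finite_subcover
    (fun B : {B : Set Γ // IsCompact B ∧ IsOpenBisection B} => B.1) (fun B => B.2.2.isOpen) (by
      intro x _
      obtain ⟨B, hB, hx, -⟩ := AmpleGroupoid.isBasis.exists_subset_of_mem_open (mem_univ x)
        isOpen_univ
      exact mem_iUnion.2 ⟨⟨B, hB⟩, hx⟩)
  exact key t f hf hfc ht

theorem convolution_mem [AmpleGroupoid Γ] {f g : Γ → R} (hf : f ∈ CcR R Γ) (hg : g ∈ CcR R Γ) :
    convolution f g ∈ CcR R Γ := by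
  have hl := isLocallyConstant_convolution hf.1 hf.2 hg.1
  refine ⟨hl, (isCompact_setMul hf.2 hg.2).of_isClosed_subset hl.isClosed_support ?_⟩
  intro γ hγ
  by_contra hn
  apply hγ
  rw [convolution]
  convert finsum_zero
  rename_i p
  obtain ⟨⟨a, b⟩, hab, e⟩ := p
  dsimp only at hab e ⊢
  by_contra hz
  exact hn ⟨a, left_ne_zero_of_mul hz, b, right_ne_zero_of_mul hz, hab, e⟩

end Convolution

/-- The Steinberg algebra `A_R(Γ)`: the `R`-module of locally constant, compactly supported functions
`Γ → R`, with convolution as multiplication. -/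
def SteinbergAlgebra (R Γ : Type*) [CommRing R] [TopologicalSpace Γ] [T2Space Γ]
    [ArrowGroupoid Γ] [AmpleGroupoid Γ] : Type _ := CcR R Γ

namespace SteinbergAlgebra
variable {R Γ : Type*} [CommRing R] [TopologicalSpace Γ] [T2Space Γ] [ArrowGroupoid Γ]
  [AmpleGroupoid Γ]

instance : FunLike (SteinbergAlgebra R Γ) Γ R where
  coe f := f.1
  coe_injective := Subtype.val_injective

noncomputable instance : AddCommGroup (SteinbergAlgebra R Γ) :=
  inferInstanceAs (AddCommGroup (CcR R Γ))

noncomputable instance : Module R (SteinbergAlgebra R Γ) :=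
  inferInstanceAs (Module R (CcR R Γ))

noncomputable instance : Mul (SteinbergAlgebra R Γ) where
  mul f g := ⟨convolution f.1 g.1, convolution_mem f.2 g.2⟩

noncomputable instance : NonUnitalNonAssocRing (SteinbergAlgebra R Γ) where
  left_distrib f g h := Subtype.ext (convolution_add_right f.2.2 g.1 h.1)
  right_distrib f g h := Subtype.ext (convolution_add_left f.2.2 g.2.2 h.1)
  zero_mul f := Subtype.ext (convolution_zero_left f.1)
  mul_zero f := Subtype.ext (convolution_zero_right f.1)

instance : IsScalarTower R (SteinbergAlgebra R Γ) (SteinbergAlgebra R Γ) where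
  smul_assoc r f g := Subtype.ext (convolution_smul_left f.2.2 r g.1)

instance : SMulCommClass R (SteinbergAlgebra R Γ) (SteinbergAlgebra R Γ) where
  smul_comm r f g := Subtype.ext (convolution_smul_right f.2.2 r g.1).symm

end SteinbergAlgebra

/-! ### Inverse semigroups, partial actions and partial skew inverse semigroup rings -/

/-- An inverse semigroup: every `s` has exactly one `s⁻¹` with `s s⁻¹ s = s` and
`s⁻¹ s s⁻¹ = s⁻¹`. -/
class InverseSemigroup (S : Type*) extends Semigroup S, Inv S where
  mul_inv_mul : ∀ s : S, s * s⁻¹ * s = s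
  inv_mul_inv : ∀ s : S, s⁻¹ * s * s⁻¹ = s⁻¹
  inv_unique : ∀ s t : S, s * t * s = s → t * s * t = t → t = s⁻¹

namespace InverseSemigroup
variable {S : Type*} [InverseSemigroup S]

theorem inv_inv (s : S) : s⁻¹⁻¹ = s :=
  (inv_unique s⁻¹ s (inv_mul_inv s) (mul_inv_mul s)).symm

/-- The natural partial order: `s ≤ t` iff `s = t s⁻¹ s`. -/
def NatLE (s t : S) : Prop := s = t * s⁻¹ * s

/-- `z` is a zero element of `S`. (A one-element semigroup, in particular the trivial group, is
regarded as having a unit and no zero.) -/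
def IsZeroElement (z : S) : Prop := (∀ t : S, z * t = z ∧ t * z = z) ∧ ∃ t : S, t ≠ z

/-- `e` is a unit of `S`. -/
def IsUnitElement (e : S) : Prop := ∀ t : S, e * t = t ∧ t * e = t

end InverseSemigroup

open InverseSemigroup

/-- A partial action `(π_s, X_s, X)` of an inverse semigroup `S` on a set `X`: subsets
`X_s = carrier s` and bijections `π_s : X_{s⁻¹} → X_s`, given by `map s`, whose values outside
`X_{s⁻¹}` play no role. -/
structure PartialAction (S X : Type*) [InverseSemigroup S] where
  carrier : S → Set X
  map : S → X → X
  bijOn : ∀ s, BijOn (map s) (carrier s⁻¹) (carrier s)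
  map_inv : ∀ s, ∀ x ∈ carrier s⁻¹, map s⁻¹ (map s x) = x
  map_inter : ∀ s t, map s '' (carrier s⁻¹ ∩ carrier t) ⊆ carrier (s * t)
  mono : ∀ s t, NatLE s t → carrier s ⊆ carrier t
  map_map : ∀ s t, ∀ x ∈ carrier t⁻¹ ∩ carrier (t⁻¹ * s⁻¹), map s (map t x) = map (s * t) x

/-- A partial action of `S` on an `R`-algebra `A`: the sets `A_s` are ideals, the bijections `π_s`
are isomorphisms of algebras, `A_0 = 0` if `S` has a zero, and `A_ε = A`, `π_ε = id` if `S` has a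
unit `ε`. -/
structure AlgebraPartialAction (R S A : Type*) [CommRing R] [InverseSemigroup S]
    [NonUnitalRing A] [Module R A] extends PartialAction S A where
  zero_mem : ∀ s, 0 ∈ carrier s
  add_mem : ∀ s, ∀ a ∈ carrier s, ∀ b ∈ carrier s, a + b ∈ carrier s
  smul_mem : ∀ s, ∀ r : R, ∀ a ∈ carrier s, r • a ∈ carrier s
  mul_mem_left : ∀ s, ∀ b, ∀ a ∈ carrier s, b * a ∈ carrier s
  mul_mem_right : ∀ s, ∀ b, ∀ a ∈ carrier s, a * b ∈ carrier s
  map_add : ∀ s, ∀ a ∈ carrier s⁻¹, ∀ b ∈ carrier s⁻¹, map s (a + b) = map s a + map s b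
  map_smul : ∀ s, ∀ r : R, ∀ a ∈ carrier s⁻¹, map s (r • a) = r • map s a
  map_mul : ∀ s, ∀ a ∈ carrier s⁻¹, ∀ b ∈ carrier s⁻¹, map s (a * b) = map s a * map s b
  carrier_zero : ∀ z, IsZeroElement z → carrier z = {0}
  carrier_unit : ∀ e, IsUnitElement e → carrier e = univ
  map_unit : ∀ e, IsUnitElement e → ∀ a, map e a = a

namespace AlgebraPartialAction
variable {R S A : Type*} [CommRing R] [InverseSemigroup S] [NonUnitalRing A] [Module R A]

/-- The ideal `A_s`, as an `R`-submodule. -/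
def ideal (π : AlgebraPartialAction R S A) (s : S) : Submodule R A where
  carrier := π.carrier s
  zero_mem' := π.zero_mem s
  add_mem' ha hb := π.add_mem s _ ha _ hb
  smul_mem' r a ha := π.smul_mem s r a ha

theorem map_inv_mem (π : AlgebraPartialAction R S A) {s : S} {a : A} (ha : a ∈ π.carrier s) :
    π.map s⁻¹ a ∈ π.carrier s⁻¹ :=
  (π.bijOn s⁻¹).mapsTo (by rwa [InverseSemigroup.inv_inv])

theorem product_mem (π : AlgebraPartialAction R S A) {s t : S} {a b : A}
    (ha : a ∈ π.carrier s) (hb : b ∈ π.carrier t) :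
    π.map s (π.map s⁻¹ a * b) ∈ π.carrier (s * t) :=
  π.map_inter s t ⟨_, ⟨π.mul_mem_right _ _ _ (π.map_inv_mem ha), π.mul_mem_left _ _ _ hb⟩, rfl⟩

variable [IsScalarTower R A A] [SMulCommClass R A A]

/-- The coefficient `π_s(π_{s⁻¹}(a) b) ∈ A_{st}` of the product `(a δ_s)(b δ_t)`. -/
def twistedMul (π : AlgebraPartialAction R S A) (s t : S) :
    π.ideal s →ₗ[R] π.ideal t →ₗ[R] π.ideal (s * t) :=
  LinearMap.mk₂ R (fun a b => ⟨π.map s (π.map s⁻¹ a * b), π.product_mem a.2 b.2⟩)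
    (fun a a' b => Subtype.ext (by
      have h1 := π.map_inv_mem a.2
      have h2 := π.map_inv_mem a'.2
      have e := π.map_add s⁻¹ (a : A) (by rw [InverseSemigroup.inv_inv]; exact a.2) (a' : A)
        (by rw [InverseSemigroup.inv_inv]; exact a'.2)
      simp only [Submodule.coe_add]
      rw [e, add_mul, π.map_add s _ (π.mul_mem_right _ _ _ h1) _ (π.mul_mem_right _ _ _ h2)]))
    (fun r a b => Subtype.ext (by
      have h1 := π.map_inv_mem a.2
      have e := π.map_smul s⁻¹ r (a : A) (by rw [InverseSemigroup.inv_inv]; exact a.2)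
      simp only [Submodule.coe_smul]
      rw [e, smul_mul_assoc, π.map_smul s r _ (π.mul_mem_right _ _ _ h1)]))
    (fun a b b' => Subtype.ext (by
      have h1 := π.map_inv_mem a.2
      simp only [Submodule.coe_add]
      rw [mul_add, π.map_add s _ (π.mul_mem_right _ _ _ h1) _ (π.mul_mem_right _ _ _ h1)]))
    (fun r a b => Subtype.ext (by
      have h1 := π.map_inv_mem a.2
      simp only [Submodule.coe_smul]
      rw [mul_smul_comm, π.map_smul s r _ (π.mul_mem_right _ _ _ h1)]))

/-- The (possibly nonassociative) algebra `𝓛` of finite formal sums `∑ a_s δ_s` with `a_s ∈ A_s`. -/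
def FormalSums (π : AlgebraPartialAction R S A) : Type _ := DirectSum S (fun s => π.ideal s)

namespace FormalSums
variable (π : AlgebraPartialAction R S A)

noncomputable instance : AddCommGroup (FormalSums π) :=
  inferInstanceAs (AddCommGroup (DirectSum S (fun s => π.ideal s)))

noncomputable instance : Module R (FormalSums π) :=
  inferInstanceAs (Module R (DirectSum S (fun s => π.ideal s)))

open Classical in
/-- `a ↦ a δ_s`, for `a ∈ A_s`. -/
noncomputable def delta (s : S) : π.ideal s →ₗ[R] FormalSums π :=
  DirectSum.lof R S (fun s => π.ideal s) s

open Classical in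
/-- The bilinear extension of `(a δ_s)(b δ_t) = π_s(π_{s⁻¹}(a) b) δ_{st}`. -/
noncomputable def mulHom : FormalSums π →ₗ[R] FormalSums π →ₗ[R] FormalSums π :=
  DirectSum.toModule R S (FormalSums π →ₗ[R] FormalSums π) fun s =>
    LinearMap.flip (DirectSum.toModule R S (π.ideal s →ₗ[R] FormalSums π) fun t =>
      LinearMap.flip ((π.twistedMul s t).compr₂ (delta π (s * t))))

noncomputable instance : Mul (FormalSums π) := ⟨fun x y => mulHom π x y⟩

theorem delta_mul_delta (s t : S) (a : π.ideal s) (b : π.ideal t) :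
    delta π s a * delta π t b =
      delta π (s * t) ⟨π.map s (π.map s⁻¹ a * b), π.product_mem a.2 b.2⟩ := by
  classical
  change mulHom π _ _ = _
  simp only [mulHom, delta]
  erw [DirectSum.toModule_lof]
  erw [LinearMap.flip_apply]
  erw [DirectSum.toModule_lof]
  rfl

noncomputable instance : NonUnitalNonAssocRing (FormalSums π) where
  left_distrib x y z := _root_.map_add (mulHom π x) y z
  right_distrib x y z := LinearMap.map_add₂ (mulHom π) x y z
  zero_mul x := LinearMap.map_zero₂ (mulHom π) x
  mul_zero x := _root_.map_zero (mulHom π x)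

/-- The elements `a δ_s - a δ_t`, where `s ≤ t` and `a ∈ A_s`. -/
def relations : Set (FormalSums π) :=
  {x | ∃ (s t : S) (h : NatLE s t) (a : π.ideal s),
    x = delta π s a - delta π t ⟨a.1, π.mono s t h a.2⟩}

/-- The two-sided ideal `𝓝` generated by the elements `a δ_s - a δ_t`, where `s ≤ t` and `a ∈ A_s`.
(This set of generators is stable under scalars, so that the ring ideal and the algebra ideal
generated by it are the same.) -/
noncomputable def relIdeal : Submodule R (FormalSums π) :=
  sInf {N | relations π ⊆ N ∧ ∀ x, ∀ y ∈ N, x * y ∈ N ∧ y * x ∈ N}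

theorem mul_mem_relIdeal {x y : FormalSums π} (hy : y ∈ relIdeal π) :
    x * y ∈ relIdeal π ∧ y * x ∈ relIdeal π := by
  simp only [relIdeal, Submodule.mem_sInf] at hy ⊢
  exact ⟨fun N hN => (hN.2 x y (hy N hN)).1, fun N hN => (hN.2 x y (hy N hN)).2⟩

end FormalSums

open FormalSums

/-- The partial skew inverse semigroup ring `A ⋊_π S = 𝓛 / 𝓝`. -/
def SkewRing (π : AlgebraPartialAction R S A) : Type _ := FormalSums π ⧸ relIdeal π

namespace SkewRing
variable (π : AlgebraPartialAction R S A)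

noncomputable instance : AddCommGroup (SkewRing π) :=
  inferInstanceAs (AddCommGroup (FormalSums π ⧸ relIdeal π))

noncomputable instance : Module R (SkewRing π) :=
  inferInstanceAs (Module R (FormalSums π ⧸ relIdeal π))

/-- The quotient map. -/
noncomputable def mk : FormalSums π →ₗ[R] SkewRing π := (relIdeal π).mkQ

/-- The multiplication of the quotient. -/
noncomputable def mulHom : SkewRing π →ₗ[R] SkewRing π →ₗ[R] SkewRing π :=
  ((relIdeal π).liftQ
    ((relIdeal π).liftQ ((FormalSums.mulHom π).compr₂ (mk π)) (by
      intro y hy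
      rw [LinearMap.mem_ker]
      ext1 x
      exact (Submodule.Quotient.mk_eq_zero _).2 (mul_mem_relIdeal π (x := x) hy).2)).flip (by
    intro y hy
    rw [LinearMap.mem_ker]
    refine LinearMap.ext fun q => ?_
    obtain ⟨x, rfl⟩ := (relIdeal π).mkQ_surjective q
    exact (Submodule.Quotient.mk_eq_zero _).2 (mul_mem_relIdeal π (x := x) hy).1)).flip

noncomputable instance : Mul (SkewRing π) := ⟨fun x y => mulHom π x y⟩

theorem mk_mul (x y : FormalSums π) : mk π (x * y) = mk π x * mk π y := rfl

noncomputable instance : NonUnitalNonAssocRing (SkewRing π) where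
  left_distrib x y z := _root_.map_add (mulHom π x) y z
  right_distrib x y z := LinearMap.map_add₂ (mulHom π) x y z
  zero_mul x := LinearMap.map_zero₂ (mulHom π) x
  mul_zero x := _root_.map_zero (mulHom π x)

instance : IsScalarTower R (SkewRing π) (SkewRing π) where
  smul_assoc r x y := LinearMap.map_smul₂ (mulHom π) r x y

instance : SMulCommClass R (SkewRing π) (SkewRing π) where
  smul_comm r x y := (_root_.map_smul (mulHom π x) r y).symm

end SkewRing
end AlgebraPartialAction

/-- A `G`-grading of an inverse semigroup: a map `w` to `G`, multiplicative wherever the product is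
nonzero. The value at a zero element plays no role. -/
structure SemigroupGrading (S G : Type*) [InverseSemigroup S] [Group G] where
  deg : S → G
  deg_mul : ∀ s t, ¬ IsZeroElement (s * t) → deg (s * t) = deg s * deg t

/-- The component of degree `g` of `A ⋊_π S`: the span of the classes of the elements `a δ_s` with
`s` nonzero of degree `g` and `a ∈ A_s`. -/
noncomputable def AlgebraPartialAction.SkewRing.component {R S A G : Type*} [CommRing R] [InverseSemigroup S]
    [NonUnitalRing A] [Module R A] [IsScalarTower R A A] [SMulCommClass R A A] [Group G]
    (π : AlgebraPartialAction R S A) (w : SemigroupGrading S G) (g : G) :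
    Submodule R (SkewRing π) :=
  Submodule.span R {x | ∃ s, ¬ IsZeroElement s ∧ w.deg s = g ∧
    ∃ a : π.ideal s, x = SkewRing.mk π (FormalSums.delta π s a)}

/-! ### Graded algebras -/

open Classical in
/-- `𝒜` makes the `R`-algebra `A` a `G`-graded algebra: `A` is the direct sum of the submodules
`𝒜 g`, and `𝒜 g * 𝒜 h ⊆ 𝒜 (g h)`. -/
def IsAlgebraGrading {R A G : Type*} [CommRing R] [NonUnitalNonAssocRing A] [Module R A] [Group G]
    (𝒜 : G → Submodule R A) : Prop :=
  DirectSum.IsInternal 𝒜 ∧ ∀ g h, ∀ a ∈ 𝒜 g, ∀ b ∈ 𝒜 h, a * b ∈ 𝒜 (g * h)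

/-- `A` and `B`, with the families of homogeneous components `𝒜` and `ℬ`, are `G`-graded algebras,
and there is an isomorphism of `R`-algebras from `A` to `B` that preserves the grading. -/
def GradedIsomorphic {R A B G : Type*} [CommRing R] [NonUnitalNonAssocRing A] [Module R A]
    [NonUnitalNonAssocRing B] [Module R B] [Group G]
    (𝒜 : G → Submodule R A) (ℬ : G → Submodule R B) : Prop :=
  IsAlgebraGrading 𝒜 ∧ IsAlgebraGrading ℬ ∧
    ∃ φ : A ≃ₗ[R] B, (∀ x y, φ (x * y) = φ x * φ y) ∧
      ∀ g, (𝒜 g).map (φ : A →ₗ[R] B) = ℬ g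

/-! ### Graded groupoids and the inverse semigroup of graded compact open bisections -/

/-- A `G`-grading of a topological groupoid: a continuous 1-cocycle to the discrete group `G`. -/
structure Cocycle (Γ G : Type*) [TopologicalSpace Γ] [ArrowGroupoid Γ] [Group G] where
  deg : Γ → G
  isLocallyConstant : IsLocallyConstant deg
  deg_comp : ∀ x y h, deg (comp x y h) = deg x * deg y

section
variable {Γ G : Type*} [TopologicalSpace Γ] [ArrowGroupoid Γ] [Group G]

theorem Cocycle.deg_unit (c : Cocycle Γ G) {u : Γ} (hu : u ∈ unitSpace Γ) : c.deg u = 1 := by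
  have h := c.deg_comp u (dom u) (by simp)
  rw [comp_dom, mem_unitSpace_iff.1 hu] at h
  exact left_eq_mul.1 h

theorem Cocycle.deg_inv (c : Cocycle Γ G) (x : Γ) : c.deg (inv x) = (c.deg x)⁻¹ := by
  have h := c.deg_comp (inv x) x (by simp)
  rw [inv_comp, c.deg_unit (dom_mem x)] at h
  exact eq_inv_of_mul_eq_one_left h.symm

/-- The homogeneous components of the Steinberg algebra: the functions supported in `c⁻¹(g)`. -/
def SteinbergAlgebra.component (R : Type*) [CommRing R] [T2Space Γ] [AmpleGroupoid Γ]
    (c : Cocycle Γ G) (g : G) : Submodule R (SteinbergAlgebra R Γ) where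
  carrier := {f | ∀ x, f x ≠ 0 → c.deg x = g}
  zero_mem' x hx := absurd rfl hx
  add_mem' {f f'} hf hf' x hx := by
    by_cases h : f x = 0
    · refine hf' x fun h' => hx ?_
      change f x + f' x = 0
      rw [h, h', add_zero]
    · exact hf x h
  smul_mem' r f hf x hx := by
    refine hf x fun h => hx ?_
    change r * f x = 0
    rw [h, mul_zero]

/-- `𝒢^(h)`: the compact open bisections that are contained in some `c⁻¹(g)`. -/
@[ext]
structure GradedBisection (c : Cocycle Γ G) where
  carrier : Set Γ
  isCompact : IsCompact carrier
  isBisection : IsOpenBisection carrier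
  graded : ∃ g, ∀ x ∈ carrier, c.deg x = g

namespace GradedBisection
variable [T2Space Γ] [EtaleGroupoid Γ] {c : Cocycle Γ G}

theorem dom_inj (B : GradedBisection c) : InjOn dom B.carrier :=
  (isOpenBisection_iff.1 B.isBisection).2.1

theorem rng_inj (B : GradedBisection c) : InjOn rng B.carrier :=
  (isOpenBisection_iff.1 B.isBisection).2.2

instance : Mul (GradedBisection c) where
  mul B C :=
    { carrier := setMul B.carrier C.carrier
      isCompact := isCompact_setMul B.isCompact C.isCompact
      isBisection := B.isBisection.mul C.isBisection
      graded := by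
        obtain ⟨g, hg⟩ := B.graded
        obtain ⟨h, hh⟩ := C.graded
        refine ⟨g * h, ?_⟩
        rintro _ ⟨b, hb, d, hd, e, rfl⟩
        rw [c.deg_comp, hg b hb, hh d hd] }

instance : Inv (GradedBisection c) where
  inv B :=
    { carrier := setInv B.carrier
      isCompact := isCompact_setInv B.isCompact
      isBisection := B.isBisection.inv
      graded := by
        obtain ⟨g, hg⟩ := B.graded
        refine ⟨g⁻¹, ?_⟩
        rintro _ ⟨b, hb, rfl⟩
        rw [c.deg_inv, hg b hb] }

theorem carrier_mul (B C : GradedBisection c) : (B * C).carrier = setMul B.carrier C.carrier := rfl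
theorem carrier_inv (B : GradedBisection c) : (B⁻¹).carrier = setInv B.carrier := rfl

theorem mul_inv_mul' (B : GradedBisection c) : B * B⁻¹ * B = B := by
  ext x
  constructor
  · rintro ⟨_, ⟨b, hb, _, ⟨b', hb', rfl⟩, h, rfl⟩, b'', hb'', h', rfl⟩
    have e : b = b' := B.dom_inj hb hb' (by simpa using h)
    subst e
    have h2 : b = b'' := B.rng_inj hb hb'' (by simpa using h')
    subst h2
    rw [comp_congr (comp_inv b) rfl, comp_rng]
    exact hb
  · intro hx
    refine ⟨_, ⟨x, hx, _, ⟨x, hx, rfl⟩, by simp, rfl⟩, x, hx, by simp, ?_⟩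
    rw [comp_congr (comp_inv x) rfl, comp_rng]

theorem inv_inv' (B : GradedBisection c) : B⁻¹⁻¹ = B := by
  ext x
  rw [carrier_inv, mem_setInv, carrier_inv, mem_setInv, ArrowGroupoid.inv_inv]

theorem inv_subset_of_mul (B C : GradedBisection c) (h : B * C * B = B) {x : Γ}
    (hx : x ∈ B.carrier) : inv x ∈ C.carrier := by
  have hx' := hx
  rw [← h] at hx'
  obtain ⟨_, ⟨b, hb, d, hd, h1, rfl⟩, b', hb', h2, rfl⟩ := hx'
  have h2' : dom d = rng b' := by simpa using h2
  have e1 : comp (comp b d h1) b' h2 = b := B.rng_inj hx hb (by simp)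
  have e2 : comp (comp b d h1) b' h2 = b' := B.dom_inj hx hb' (by simp)
  rw [e1]
  have e3 : b = b' := e1.symm.trans e2
  subst e3
  have e4 : comp b d h1 = rng b := by
    have := assoc b d b h1 h2'
    rw [e1] at this
    have h5 := inv_comp_cancel (x := b) (y := comp d b h2') (by simpa using h1)
    rw [comp_congr rfl this.symm, inv_comp] at h5
    have h6 := eq_inv_of_comp h2' (by rw [← h5, h1])
    have h7 : d = inv b := by rw [h6, ArrowGroupoid.inv_inv]
    subst h7
    simp
  rw [← eq_inv_of_comp h1 e4]
  exact hd

instance : InverseSemigroup (GradedBisection c) where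
  mul_assoc B C D := GradedBisection.ext (setMul_assoc _ _ _)
  mul_inv_mul := mul_inv_mul'
  inv_mul_inv B := by
    have := mul_inv_mul' B⁻¹
    rwa [inv_inv'] at this
  inv_unique B C h1 h2 := by
    ext x
    rw [carrier_inv, mem_setInv]
    constructor
    · exact inv_subset_of_mul C B h2
    · intro h
      have := inv_subset_of_mul B C h1 h
      rwa [ArrowGroupoid.inv_inv] at this

theorem subset_of_natLE {B C : GradedBisection c} (h : NatLE B C) : B.carrier ⊆ C.carrier := by
  intro x hx
  have hx' := hx
  rw [show B = C * B⁻¹ * B from h] at hx'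
  obtain ⟨_, ⟨d, hd, _, ⟨b, hb, rfl⟩, h1, rfl⟩, b', hb', h2, rfl⟩ := hx'
  have e : b = b' := B.rng_inj hb hb' (by simpa using h2)
  subst e
  have : comp (comp d (inv b) h1) b h2 = d := by
    have h1' : dom d = dom b := by simpa using h1
    rw [assoc d (inv b) b h1 (by simp), comp_congr rfl ((inv_comp b).trans h1'.symm), comp_dom]
  rw [this]
  exact hd

open Classical in
/-- The degree map `B ↦ g` for nonempty `B ⊆ c⁻¹(g)`. -/
noncomputable def grading (c : Cocycle Γ G) : SemigroupGrading (GradedBisection c) G where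
  deg B := if h : B.carrier.Nonempty then c.deg h.some else 1
  deg_mul B C h := by
    have key : ∀ D : GradedBisection c, ∀ x ∈ D.carrier,
        (if h : D.carrier.Nonempty then c.deg h.some else 1) = c.deg x := by
      intro D x hx
      obtain ⟨g, hg⟩ := D.graded
      have hD : D.carrier.Nonempty := ⟨x, hx⟩
      rw [dif_pos hD, hg _ hD.some_mem, hg x hx]
    by_cases hne : (B * C).carrier.Nonempty
    · obtain ⟨x, hx⟩ := hne
      rw [key _ x hx]
      obtain ⟨b, hb, d, hd, e, rfl⟩ := hx
      rw [key _ b hb, key _ d hd, c.deg_comp]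
    · rw [dif_neg hne]
      rw [not_nonempty_iff_eq_empty] at hne
      have hz : ∀ D : GradedBisection c, D = B * C := by
        by_contra! hn
        refine h ⟨fun t => ⟨GradedBisection.ext ?_, GradedBisection.ext ?_⟩, hn⟩
        · rw [carrier_mul, hne]; simp [setMul]
        · rw [carrier_mul t, hne]; simp [setMul]
      have h1 : ∀ D : GradedBisection c, ¬ D.carrier.Nonempty := by
        intro D; rw [hz D, hne]; simp
      rw [dif_neg (h1 B), dif_neg (h1 C), mul_one]

end GradedBisection

/-! ### Open invariant subsets of the unit space, and the induced partial actions -/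

variable (Γ) in
/-- An open invariant subset of the unit space. (The unit space of an étale groupoid is open, so
"open in the unit space" and "open in the space of arrows" agree.) -/
structure OpenInvariant where
  carrier : Set Γ
  subset_unitSpace : carrier ⊆ unitSpace Γ
  isOpen : IsOpen carrier
  invariant : ∀ x, dom x ∈ carrier → rng x ∈ carrier

/-- The whole unit space. -/
def OpenInvariant.whole [EtaleGroupoid Γ] : OpenInvariant Γ where
  carrier := unitSpace Γ
  subset_unitSpace := Subset.rfl
  isOpen := isOpen_unitSpace
  invariant x _ := rng_mem x

namespace OpenInvariant

theorem invariant' (U : OpenInvariant Γ) {x : Γ} (h : rng x ∈ U.carrier) : dom x ∈ U.carrier := by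
  have := U.invariant (inv x) (by simpa using h)
  simpa using this

/-- `𝒢_U = d⁻¹(U)`. -/
abbrev Restriction (U : OpenInvariant Γ) : Type _ := {x : Γ // dom x ∈ U.carrier}

/-- The groupoid structure that `𝒢_U` inherits as a subgroupoid. -/
instance (U : OpenInvariant Γ) : ArrowGroupoid U.Restriction where
  dom x := ⟨dom x.1, by rw [dom_dom]; exact x.2⟩
  rng x := ⟨rng x.1, by rw [dom_rng]; exact U.invariant _ x.2⟩
  inv x := ⟨inv x.1, by rw [dom_inv]; exact U.invariant _ x.2⟩
  comp x y h := ⟨comp x.1 y.1 (congrArg Subtype.val h), by rw [dom_comp]; exact y.2⟩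
  dom_dom _ := Subtype.ext (dom_dom _)
  rng_dom _ := Subtype.ext (rng_dom _)
  dom_rng _ := Subtype.ext (dom_rng _)
  rng_rng _ := Subtype.ext (rng_rng _)
  dom_comp _ _ _ := Subtype.ext (dom_comp _ _ _)
  rng_comp _ _ _ := Subtype.ext (rng_comp _ _ _)
  comp_dom _ := Subtype.ext (comp_dom _)
  comp_rng _ := Subtype.ext (comp_rng _)
  assoc _ _ _ _ _ := Subtype.ext (assoc _ _ _ _ _)
  dom_inv _ := Subtype.ext (dom_inv _)
  rng_inv _ := Subtype.ext (rng_inv _)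
  inv_comp _ := Subtype.ext (inv_comp _)
  comp_inv _ := Subtype.ext (comp_inv _)

theorem isOpenEmbedding_val [EtaleGroupoid Γ] (U : OpenInvariant Γ) :
    IsOpenEmbedding (Subtype.val : U.Restriction → Γ) :=
  (U.isOpen.preimage continuous_dom).isOpenEmbedding_subtypeVal

instance [EtaleGroupoid Γ] (U : OpenInvariant Γ) : TopologicalGroupoid U.Restriction where
  continuous_inv := (TopologicalGroupoid.continuous_inv.comp continuous_subtype_val).subtype_mk _
  continuous_comp := by
    refine Continuous.subtype_mk (TopologicalGroupoid.continuous_comp.comp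
      (g := fun p : {p : Γ × Γ // dom p.1 = rng p.2} => comp p.1.1 p.1.2 p.2)
      (f := fun p : {p : U.Restriction × U.Restriction // dom p.1 = rng p.2} =>
        ⟨(p.1.1.1, p.1.2.1), congrArg Subtype.val p.2⟩) ?_) _
    refine Continuous.subtype_mk (Continuous.prodMk ?_ ?_) _
    · exact continuous_subtype_val.comp (continuous_fst.comp continuous_subtype_val)
    · exact continuous_subtype_val.comp (continuous_snd.comp continuous_subtype_val)

instance [EtaleGroupoid Γ] (U : OpenInvariant Γ) : EtaleGroupoid U.Restriction where
  isLocalHomeomorph_domU := by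
    have hd : IsLocalHomeomorph (dom : Γ → Γ) :=
      isOpen_unitSpace.isOpenEmbedding_subtypeVal.isLocalHomeomorph.comp
        EtaleGroupoid.isLocalHomeomorph_domU
    have hu : unitSpace U.Restriction = Subtype.val ⁻¹' unitSpace Γ := by
      ext x
      rw [mem_preimage, mem_unitSpace_iff, mem_unitSpace_iff]
      exact Subtype.ext_iff
    have ho : IsOpen (unitSpace U.Restriction) := by
      rw [hu]; exact isOpen_unitSpace.preimage U.isOpenEmbedding_val.continuous
    have hg : IsLocalHomeomorph (fun u : unitSpace U.Restriction => (u.1.1 : Γ)) :=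
      U.isOpenEmbedding_val.isLocalHomeomorph.comp ho.isOpenEmbedding_subtypeVal.isLocalHomeomorph
    refine IsLocalHomeomorph.of_comp (f := domU) (g := fun u : unitSpace U.Restriction => (u.1.1 : Γ))
      (hd.comp U.isOpenEmbedding_val.isLocalHomeomorph) hg ?_
    exact ((continuous_dom.comp U.isOpenEmbedding_val.continuous).subtype_mk _).subtype_mk _

instance [AmpleGroupoid Γ] (U : OpenInvariant Γ) : AmpleGroupoid U.Restriction where
  isBasis := by
    refine TopologicalSpace.isTopologicalBasis_of_isOpen_of_nhds (fun B hB => hB.2.isOpen) ?_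
    intro x W hx hW
    obtain ⟨B, ⟨hBc, hB⟩, hxB, hBW⟩ := AmpleGroupoid.isBasis.exists_subset_of_mem_open
      (mem_image_of_mem _ hx) (U.isOpenEmbedding_val.isOpenMap _ hW)
    obtain ⟨oB, dB, rB⟩ := isOpenBisection_iff.1 hB
    refine ⟨Subtype.val ⁻¹' B, ⟨?_, isOpenBisection_iff.2 ⟨?_, ?_, ?_⟩⟩, hxB, ?_⟩
    · refine U.isOpenEmbedding_val.isInducing.isCompact_preimage' hBc ?_
      exact hBW.trans (image_subset_range _ _)
    · exact oB.preimage U.isOpenEmbedding_val.continuous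
    · exact fun y hy z hz e => Subtype.ext (dB hy hz (congrArg Subtype.val e))
    · exact fun y hy z hz e => Subtype.ext (rB hy hz (congrArg Subtype.val e))
    · intro y hy
      obtain ⟨z, hz, e⟩ := hBW hy
      rwa [← Subtype.ext e]

/-- The grading of `𝒢_U` inherited from `𝒢`. -/
def _root_.Cocycle.restrict [EtaleGroupoid Γ] (c : Cocycle Γ G) (U : OpenInvariant Γ) :
    Cocycle U.Restriction G where
  deg x := c.deg x.1
  isLocallyConstant := c.isLocallyConstant.comp_continuous U.isOpenEmbedding_val.continuous
  deg_comp x y _ := c.deg_comp x.1 y.1 _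

end OpenInvariant
end

namespace OpenInvariant
section
variable {Γ G : Type*} [TopologicalSpace Γ] [ArrowGroupoid Γ] [Group G]
  [T2Space Γ] [EtaleGroupoid Γ] {c : Cocycle Γ G}

open Classical in
/-- `π_B(u) = r(b)` if `u = d(b)` with `b ∈ B`. -/
noncomputable def unitMap (U : OpenInvariant Γ) (B : GradedBisection c) (u : U.carrier) :
    U.carrier :=
  if h : ∃ b ∈ B.carrier, dom b = u then
    ⟨rng h.choose, U.invariant _ (by rw [h.choose_spec.2]; exact u.2)⟩
  else u

theorem unitMap_eq (U : OpenInvariant Γ) (B : GradedBisection c) {b : Γ} (hb : b ∈ B.carrier)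
    (u : U.carrier) (hu : dom b = u) : (U.unitMap B u : Γ) = rng b := by
  have h : ∃ b ∈ B.carrier, dom b = u := ⟨b, hb, hu⟩
  rw [unitMap, dif_pos h]
  exact congrArg rng (B.dom_inj h.choose_spec.1 hb (h.choose_spec.2.trans hu.symm))

/-- `U_B = r(B) ∩ U`, as a subset of `U`. -/
def unitCarrier (U : OpenInvariant Γ) (B : GradedBisection c) : Set U.carrier :=
  {u | (u : Γ) ∈ rng '' B.carrier}

theorem mem_unitCarrier_inv (U : OpenInvariant Γ) (B : GradedBisection c) {u : U.carrier} :
    u ∈ U.unitCarrier B⁻¹ ↔ ∃ b ∈ B.carrier, dom b = u := by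
  constructor
  · rintro ⟨_, ⟨b, hb, rfl⟩, h⟩
    exact ⟨b, hb, by simpa using h⟩
  · rintro ⟨b, hb, h⟩
    exact ⟨_, ⟨b, hb, rfl⟩, by simpa using h⟩

variable (c) in
/-- The partial action `(π_B, U_B, U)` of `𝒢^(h)` on `U`. -/
noncomputable def unitAction (U : OpenInvariant Γ) : PartialAction (GradedBisection c) U.carrier where
  carrier := U.unitCarrier
  map := U.unitMap
  bijOn B := by
    refine ⟨?_, ?_, ?_⟩
    · intro u hu
      obtain ⟨b, hb, h⟩ := (U.mem_unitCarrier_inv B).1 hu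
      exact ⟨b, hb, (U.unitMap_eq B hb u h).symm⟩
    · intro u hu v hv e
      obtain ⟨b, hb, h⟩ := (U.mem_unitCarrier_inv B).1 hu
      obtain ⟨b', hb', h'⟩ := (U.mem_unitCarrier_inv B).1 hv
      have e' := congrArg Subtype.val e
      rw [U.unitMap_eq B hb u h, U.unitMap_eq B hb' v h'] at e'
      exact Subtype.ext (by rw [← h, ← h', B.rng_inj hb hb' e'])
    · rintro u ⟨b, hb, h⟩
      refine ⟨⟨dom b, U.invariant' (by rw [h]; exact u.2)⟩,
        (U.mem_unitCarrier_inv B).2 ⟨b, hb, rfl⟩, Subtype.ext ?_⟩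
      rw [U.unitMap_eq B hb _ rfl, h]
  map_inv B u hu := by
    obtain ⟨b, hb, h⟩ := (U.mem_unitCarrier_inv B).1 hu
    apply Subtype.ext
    rw [U.unitMap_eq B⁻¹ ⟨b, hb, rfl⟩ _ (by rw [dom_inv, U.unitMap_eq B hb u h]), rng_inv, h]
  map_inter B C := by
    rintro _ ⟨u, ⟨hu, d, hd, hdu⟩, rfl⟩
    obtain ⟨b, hb, h⟩ := (U.mem_unitCarrier_inv B).1 hu
    exact ⟨_, ⟨b, hb, d, hd, h.trans hdu.symm, rfl⟩, by rw [rng_comp, U.unitMap_eq B hb u h]⟩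
  mono B C h := by
    rintro u ⟨b, hb, hu⟩
    exact ⟨b, GradedBisection.subset_of_natLE h hb, hu⟩
  map_map B C := by
    rintro u ⟨-, _, ⟨_, ⟨d, hd, rfl⟩, _, ⟨b, hb, rfl⟩, h, rfl⟩, hu⟩
    have hdu : dom d = u := by simpa using hu
    have hbd : dom b = rng d := by simpa using h.symm
    apply Subtype.ext
    rw [U.unitMap_eq B hb _ (by rw [U.unitMap_eq C hd u hdu, hbd]),
      U.unitMap_eq (B * C) ⟨b, hb, d, hd, hbd, rfl⟩ u (by simpa using hdu), rng_comp]

theorem isClopen_unitCarrier (U : OpenInvariant Γ) (B : GradedBisection c) :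
    IsClopen (U.unitCarrier B) :=
  ⟨(B.isCompact.image continuous_rng).isClosed.preimage continuous_subtype_val,
    (isOpenMap_rng _ B.isBisection.isOpen).preimage continuous_subtype_val⟩

theorem continuous_unitMap (U : OpenInvariant Γ) (B : GradedBisection c) :
    Continuous (fun u : U.unitCarrier B => U.unitMap B⁻¹ u) := by
  obtain ⟨σ, hσ, hm, hr⟩ := B.isBisection.exists_section
  rw [Topology.IsInducing.subtypeVal.continuous_iff]
  have : Continuous (fun u : U.unitCarrier B => dom (σ ⟨(u.1 : Γ), u.2⟩)) :=
    continuous_dom.comp (hσ.comp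
      ((continuous_subtype_val.comp continuous_subtype_val).subtype_mk _))
  convert this using 1
  ext u
  rw [Function.comp_apply, U.unitMap_eq B⁻¹ ⟨_, hm ⟨(u.1 : Γ), u.2⟩, rfl⟩ u.1 (by rw [dom_inv, hr]), rng_inv]

open Classical in
/-- `π_B(f) = f ∘ π_B⁻¹` on `U_B`, extended by zero. -/
noncomputable def functionMap (R : Type*) [CommRing R] (U : OpenInvariant Γ)
    (B : GradedBisection c) (f : CcR R U.carrier) : CcR R U.carrier :=
  ⟨fun u => if u ∈ U.unitCarrier B then f.1 (U.unitMap B⁻¹ u) else 0, by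
    have hl : IsLocallyConstant
        (fun u => if u ∈ U.unitCarrier B then f.1 (U.unitMap B⁻¹ u) else 0) := by
      have := IsLocallyConstant.dite_zero (U.isClopen_unitCarrier B)
        (f.2.1.comp_continuous (U.continuous_unitMap B))
      convert this using 1
      ext u
      simp
    refine ⟨hl, ?_⟩
    have h1 : IsCompact (Subtype.val '' Function.support f.1 : Set Γ) :=
      f.2.2.image continuous_subtype_val
    have h2 : IsCompact (rng '' (B.carrier ∩ dom ⁻¹' (Subtype.val '' Function.support f.1))) :=
      (B.isCompact.inter_right (h1.isClosed.preimage continuous_dom)).image continuous_rng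
    have h3 : IsCompact ((Subtype.val : U.carrier → Γ) ⁻¹'
        (rng '' (B.carrier ∩ dom ⁻¹' (Subtype.val '' Function.support f.1)))) := by
      refine Topology.IsInducing.subtypeVal.isCompact_preimage' h2 ?_
      rintro _ ⟨b, ⟨-, u, -, hu⟩, rfl⟩
      exact ⟨⟨rng b, U.invariant b (by rw [← hu]; exact u.2)⟩, rfl⟩
    refine h3.of_isClosed_subset hl.isClosed_support ?_
    intro u hu
    have hu' : (if u ∈ U.unitCarrier B then f.1 (U.unitMap B⁻¹ u) else 0) ≠ 0 := hu
    by_cases h : u ∈ U.unitCarrier B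
    · rw [if_pos h] at hu'
      obtain ⟨b, hb, hbu⟩ := h
      refine ⟨b, ⟨hb, _, hu', ?_⟩, hbu⟩
      rw [U.unitMap_eq B⁻¹ ⟨b, hb, rfl⟩ u (by rw [dom_inv, hbu]), rng_inv]
    · rw [if_neg h] at hu'
      exact absurd rfl hu'⟩

theorem functionMap_of_mem {R : Type*} [CommRing R] (U : OpenInvariant Γ) (B : GradedBisection c)
    (f : CcR R U.carrier) {u : U.carrier} (hu : u ∈ U.unitCarrier B) :
    (U.functionMap R B f).1 u = f.1 (U.unitMap B⁻¹ u) := if_pos hu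

theorem functionMap_of_notMem {R : Type*} [CommRing R] (U : OpenInvariant Γ)
    (B : GradedBisection c) (f : CcR R U.carrier) {u : U.carrier} (hu : u ∉ U.unitCarrier B) :
    (U.functionMap R B f).1 u = 0 := if_neg hu

theorem functionMap_mul {R : Type*} [CommRing R] (U : OpenInvariant Γ) (B C : GradedBisection c)
    (f : CcR R U.carrier) :
    U.functionMap R B (U.functionMap R C f) = U.functionMap R (B * C) f := by
  apply Subtype.ext
  ext u
  by_cases hu : u ∈ U.unitCarrier (B * C)
  · obtain ⟨_, ⟨b, hb, d, hd, h, rfl⟩, hx⟩ := hu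
    have hbu : rng b = u := by simpa using hx
    have e1 : (U.unitMap B⁻¹ u : Γ) = dom b := by
      rw [U.unitMap_eq B⁻¹ ⟨b, hb, rfl⟩ u (by rw [dom_inv, hbu]), rng_inv]
    have e2 : (U.unitMap C⁻¹ (U.unitMap B⁻¹ u) : Γ) = dom d := by
      rw [U.unitMap_eq C⁻¹ ⟨d, hd, rfl⟩ _ (by rw [dom_inv, e1, h]), rng_inv]
    have e3 : (U.unitMap (B * C)⁻¹ u : Γ) = dom d := by
      rw [U.unitMap_eq (B * C)⁻¹ ⟨_, ⟨b, hb, d, hd, h, rfl⟩, rfl⟩ u (by rw [dom_inv, hx]), rng_inv,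
        dom_comp]
    rw [U.functionMap_of_mem B _ ⟨b, hb, hbu⟩, U.functionMap_of_mem C _ ⟨d, hd, by rw [e1, h]⟩,
      U.functionMap_of_mem (B * C) _ ⟨_, ⟨b, hb, d, hd, h, rfl⟩, hx⟩, Subtype.ext (e2.trans e3.symm)]
  · rw [U.functionMap_of_notMem (B * C) _ hu]
    by_cases hB : u ∈ U.unitCarrier B
    · rw [U.functionMap_of_mem B _ hB]
      refine U.functionMap_of_notMem C _ fun hC => hu ?_
      obtain ⟨b, hb, hbu⟩ := hB
      obtain ⟨d, hd, hdu⟩ := hC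
      rw [U.unitMap_eq B⁻¹ ⟨b, hb, rfl⟩ u (by rw [dom_inv, hbu]), rng_inv] at hdu
      exact ⟨_, ⟨b, hb, d, hd, hdu.symm, rfl⟩, by rw [rng_comp, hbu]⟩
    · exact U.functionMap_of_notMem B _ hB

theorem functionMap_inv {R : Type*} [CommRing R] (U : OpenInvariant Γ) (B : GradedBisection c)
    {f : CcR R U.carrier} (hf : ∀ u, u ∉ U.unitCarrier B⁻¹ → f.1 u = 0) :
    U.functionMap R B⁻¹ (U.functionMap R B f) = f := by
  apply Subtype.ext
  ext u
  by_cases hu : u ∈ U.unitCarrier B⁻¹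
  · have h1 : U.unitMap B⁻¹⁻¹ u = U.unitMap B u := by rw [InverseSemigroup.inv_inv]
    have h2 : U.unitMap B u ∈ U.unitCarrier B := ((U.unitAction c).bijOn B).mapsTo hu
    rw [U.functionMap_of_mem B⁻¹ _ hu, h1, U.functionMap_of_mem B _ h2]
    exact congrArg f.1 ((U.unitAction c).map_inv B u hu)
  · rw [U.functionMap_of_notMem B⁻¹ _ hu, hf u hu]

end

section
variable {Γ G : Type*} [TopologicalSpace Γ] [ArrowGroupoid Γ] [Group G]
  [T2Space Γ] [AmpleGroupoid Γ] {c : Cocycle Γ G}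

/-- Every unit lies in a graded compact open bisection that consists of units. -/
theorem exists_unit_bisection (c : Cocycle Γ G) {u : Γ} (hu : u ∈ unitSpace Γ) :
    ∃ K : GradedBisection c, u ∈ K.carrier ∧ K.carrier ⊆ unitSpace Γ := by
  obtain ⟨B, ⟨hBc, hB⟩, huB, hBU⟩ := AmpleGroupoid.isBasis.exists_subset_of_mem_open hu
    isOpen_unitSpace
  exact ⟨⟨B, hBc, hB, 1, fun x hx => c.deg_unit (hBU hx)⟩, huB, hBU⟩

theorem mem_of_isUnitElement {e : GradedBisection c} (he : IsUnitElement e) {u : Γ}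
    (hu : u ∈ unitSpace Γ) : u ∈ e.carrier := by
  obtain ⟨K, huK, hK⟩ := exists_unit_bisection c hu
  have h1 : u ∈ (e * K).carrier := by rw [(he K).1]; exact huK
  obtain ⟨a, ha, k, hk, h, hx⟩ := h1
  have hak : comp a k h = a := by
    have hk' : k = dom a := by rw [h, rng_of_mem_unitSpace (hK hk)]
    rw [comp_congr rfl hk', comp_dom]
  rw [← hx, hak]
  exact ha

variable (c) in
/-- The induced partial action `(π_B, C_R(U_B), C_R(U))` of `𝒢^(h)` on `C_R(U)`. Here `C_R(U_B)` is
identified, through extension by zero, with the ideal of the functions in `C_R(U)` that vanish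
outside the open set `U_B`. -/
noncomputable def functionAction (R : Type*) [CommRing R] (U : OpenInvariant Γ) :
    AlgebraPartialAction R (GradedBisection c) (CcR R U.carrier) where
  carrier B := {f | ∀ u, u ∉ U.unitCarrier B → f.1 u = 0}
  map := U.functionMap R
  bijOn B := by
    refine ⟨fun f _ u hu => U.functionMap_of_notMem B f hu, fun f hf f' hf' e => ?_, fun f hf => ?_⟩
    · rw [← U.functionMap_inv B hf, e, U.functionMap_inv B hf']
    · refine ⟨U.functionMap R B⁻¹ f, fun u hu => U.functionMap_of_notMem B⁻¹ f hu, ?_⟩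
      have := U.functionMap_inv B⁻¹ (f := f) (by rwa [InverseSemigroup.inv_inv])
      rwa [InverseSemigroup.inv_inv] at this
  map_inv B f hf := U.functionMap_inv B hf
  map_inter B C := by
    rintro _ ⟨f, ⟨hf, hf'⟩, rfl⟩ u hu
    by_cases hB : u ∈ U.unitCarrier B
    · rw [U.functionMap_of_mem B f hB]
      refine hf' _ fun hC => hu ?_
      have hB' : u ∈ U.unitCarrier B⁻¹⁻¹ := by rwa [InverseSemigroup.inv_inv]
      have h1 := (U.unitAction c).map_inv B⁻¹ u hB'
      have h2 := ((U.unitAction c).bijOn B⁻¹).mapsTo hB'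
      rw [InverseSemigroup.inv_inv] at h1
      rw [← h1]
      exact (U.unitAction c).map_inter B C ⟨_, ⟨h2, hC⟩, rfl⟩
    · exact U.functionMap_of_notMem B f hB
  mono B C h f hf u hu := hf u fun hu' => hu ((U.unitAction c).mono B C h hu')
  map_map B C f _ := U.functionMap_mul B C f
  zero_mem B u _ := rfl
  add_mem B f hf f' hf' u hu := by
    change f.1 u + f'.1 u = 0
    rw [hf u hu, hf' u hu, add_zero]
  smul_mem B r f hf u hu := by
    change r * f.1 u = 0
    rw [hf u hu, mul_zero]
  mul_mem_left B f' f hf u hu := by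
    change f'.1 u * f.1 u = 0
    rw [hf u hu, mul_zero]
  mul_mem_right B f' f hf u hu := by
    change f.1 u * f'.1 u = 0
    rw [hf u hu, zero_mul]
  map_add B f _ f' _ := by
    apply Subtype.ext
    ext u
    change (U.functionMap R B (f + f')).1 u = (U.functionMap R B f).1 u + (U.functionMap R B f').1 u
    by_cases hu : u ∈ U.unitCarrier B
    · simp only [U.functionMap_of_mem B _ hu]; rfl
    · simp only [U.functionMap_of_notMem B _ hu, add_zero]
  map_smul B r f _ := by
    apply Subtype.ext
    ext u
    change (U.functionMap R B (r • f)).1 u = r * (U.functionMap R B f).1 u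
    by_cases hu : u ∈ U.unitCarrier B
    · simp only [U.functionMap_of_mem B _ hu]; rfl
    · simp only [U.functionMap_of_notMem B _ hu, mul_zero]
  map_mul B f _ f' _ := by
    apply Subtype.ext
    ext u
    change (U.functionMap R B (f * f')).1 u = (U.functionMap R B f).1 u * (U.functionMap R B f').1 u
    by_cases hu : u ∈ U.unitCarrier B
    · simp only [U.functionMap_of_mem B _ hu]; rfl
    · simp only [U.functionMap_of_notMem B _ hu, mul_zero]
  carrier_zero z hz := by
    have hz' : z.carrier = ∅ := by
      have := (hz.1 ⟨∅, isCompact_empty, isOpenBisection_iff.2 ⟨isOpen_empty, by simp, by simp⟩,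
        1, by simp⟩).1
      rw [← this, GradedBisection.carrier_mul]
      simp [setMul]
    ext f
    constructor
    · intro hf
      refine Subtype.ext (funext fun u => hf u ?_)
      rintro ⟨b, hb, -⟩
      rw [hz'] at hb
      exact hb
    · rintro rfl u -
      rfl
  carrier_unit e he := by
    refine eq_univ_of_forall fun f u hu => absurd ?_ hu
    exact ⟨u, mem_of_isUnitElement he (U.subset_unitSpace u.2),
      rng_of_mem_unitSpace (U.subset_unitSpace u.2)⟩
  map_unit e he f := by
    refine Subtype.ext (funext fun u => ?_)
    have hu := U.subset_unitSpace u.2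
    have hue := mem_of_isUnitElement he hu
    rw [U.functionMap_of_mem e f ⟨u, hue, rng_of_mem_unitSpace hu⟩]
    refine congrArg f.1 (Subtype.ext ?_)
    rw [U.unitMap_eq e⁻¹ ⟨u, hue, rfl⟩ u (by rw [dom_inv, rng_of_mem_unitSpace hu]), rng_inv,
      mem_unitSpace_iff.1 hu]

variable (c) in
/-- The homogeneous components of `C_R(U) ⋊_π 𝒢^(h)`. -/
noncomputable def skewComponent (R : Type*) [CommRing R] (U : OpenInvariant Γ) (g : G) :
    Submodule R (AlgebraPartialAction.SkewRing (U.functionAction c R)) :=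
  AlgebraPartialAction.SkewRing.component (U.functionAction c R) (GradedBisection.grading c) g

end
end OpenInvariant

/-!
A compact open bisection `B` turns a function `a` on `r(B) ∩ U` into a function on `𝒢_U`: the one
that equals `a ∘ r` on `B` and vanishes elsewhere. Extending `a δ_B ↦ a ∘ r|_B` linearly gives a map from
the formal sums to `A_R(𝒢_U)`. It is multiplicative because an arrow has at most one factorization
whose first factor lies in `B`, so that the convolution sum has a single term
(`OpenInvariant.bisectionFun_mul`), and it kills `a δ_B - a δ_C` for `B ⊆ C`, since `a` vanishes off
`r(B)`. It therefore descends to the skew ring (`OpenInvariant.skewToSteinberg`).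

The map is onto because every function in `A_R(𝒢_U)` can be cut along a finite cover of its support
by graded bisections. For injectivity, consider a vanishing sum of functions coming from finitely many
bisections. The function of one term `a δ_B` is then supported in the union of the other bisections
`C`, and cutting `a` into pieces supported in the sets `r(B ∩ C)`, where
`a δ_B = a δ_{B ∩ C} = a δ_C` in the skew ring, moves this term into the others
(`OpenInvariant.mk_delta_mem_iSup_of_support_subset`); so the number of terms can be lowered to zero.

The components of a Steinberg algebra form a grading, as the cocycle is locally constant
(`SteinbergAlgebra.isAlgebraGrading_component`). The images of the components of the skew ring lie in
them and span everything, hence agree with them, and the grading of the skew ring is the transported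
one. Finally, restricting to the whole unit space gives back the groupoid up to isomorphism.
-/

/-! ### Restricting functions to clopen sets -/

theorem IsLocallyConstant.indicator {R X : Type*} [Zero R] [TopologicalSpace X] {S : Set X}
    {f : X → R} (hf : IsLocallyConstant f) (hS : IsClopen S) :
    IsLocallyConstant (S.indicator f) := by
  classical
  have := IsLocallyConstant.dite_zero hS (hf.comp_continuous continuous_subtype_val)
  convert this using 1
  ext x
  simp [Set.indicator_apply]

namespace CcR
variable {R X : Type*} [CommRing R] [TopologicalSpace X]

/-- The function that agrees with `f` on the clopen set `S` and vanishes elsewhere. -/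
noncomputable def indicator {S : Set X} (hS : IsClopen S) (f : CcR R X) : CcR R X :=
  ⟨S.indicator f.1, by
    have hl := f.2.1.indicator hS
    exact ⟨hl, f.2.2.of_isClosed_subset hl.isClosed_support (by simp)⟩⟩

theorem indicator_add_compl {S : Set X} (hS : IsClopen S) (f : CcR R X) :
    indicator hS f + indicator hS.compl f = f :=
  Subtype.ext (Set.indicator_self_add_compl S f.1)

end CcR

/-! ### Graded algebras -/

section Graded
variable {R A B C G : Type*} [CommRing R] [NonUnitalNonAssocRing A] [Module R A]
  [NonUnitalNonAssocRing B] [Module R B] [NonUnitalNonAssocRing C] [Module R C]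

/-- A family of submodules that spans and lies below an independent family is equal to it. -/
theorem iSupIndep.eq_of_le_of_iSup_eq_top {𝒜 𝒮 : G → Submodule R A} (h𝒜 : iSupIndep 𝒜)
    (hle : ∀ g, 𝒮 g ≤ 𝒜 g) (htop : ⨆ g, 𝒮 g = ⊤) (g : G) : 𝒮 g = 𝒜 g := by
  refine le_antisymm (hle g) fun x hx => ?_
  have hx' : x ∈ 𝒮 g ⊔ ⨆ (h) (_ : h ≠ g), 𝒮 h := by
    rw [← iSup_split_single, htop]
    trivial
  obtain ⟨p, hp, q, hq, rfl⟩ := Submodule.mem_sup.1 hx'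
  have hq1 : q ∈ 𝒜 g := by simpa using (𝒜 g).sub_mem hx (hle g hp)
  have hq2 : q ∈ ⨆ (h) (_ : h ≠ g), 𝒜 h := iSup₂_mono (fun h _ => hle h) hq
  rw [Submodule.disjoint_def.1 (h𝒜 g) q hq1 hq2, add_zero]
  exact hp

variable [Group G]

theorem isAlgebraGrading_iff {𝒜 : G → Submodule R A} :
    IsAlgebraGrading 𝒜 ↔ (iSupIndep 𝒜 ∧ ⨆ g, 𝒜 g = ⊤) ∧
      ∀ g h, ∀ a ∈ 𝒜 g, ∀ b ∈ 𝒜 h, a * b ∈ 𝒜 (g * h) := by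
  classical
  rw [IsAlgebraGrading, DirectSum.isInternal_submodule_iff_iSupIndep_and_iSup_eq_top]

theorem IsAlgebraGrading.map {𝒜 : G → Submodule R A} (h𝒜 : IsAlgebraGrading 𝒜) (φ : A ≃ₗ[R] B)
    (hφ : ∀ x y, φ (x * y) = φ x * φ y) :
    IsAlgebraGrading fun g => (𝒜 g).map (φ : A →ₗ[R] B) := by
  rw [isAlgebraGrading_iff] at h𝒜 ⊢
  obtain ⟨⟨h1, h2⟩, h3⟩ := h𝒜
  refine ⟨⟨?_, ?_⟩, ?_⟩
  · exact h1.map_orderIso (Submodule.orderIsoMapComap φ)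
  · rw [← Submodule.map_iSup, h2, Submodule.map_top, LinearEquiv.range]
  · rintro g h _ ⟨a, ha, rfl⟩ _ ⟨b, hb, rfl⟩
    exact ⟨a * b, h3 g h a ha b hb, hφ a b⟩

theorem GradedIsomorphic.of_linearEquiv {𝒜 : G → Submodule R A} {ℬ : G → Submodule R B}
    (h𝒜 : IsAlgebraGrading 𝒜) (φ : A ≃ₗ[R] B) (hφ : ∀ x y, φ (x * y) = φ x * φ y)
    (hmap : ∀ g, (𝒜 g).map (φ : A →ₗ[R] B) = ℬ g) : GradedIsomorphic 𝒜 ℬ :=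
  ⟨h𝒜, by simpa only [hmap] using h𝒜.map φ hφ, φ, hφ, hmap⟩

theorem GradedIsomorphic.trans {𝒜 : G → Submodule R A} {ℬ : G → Submodule R B}
    {𝒞 : G → Submodule R C} (h : GradedIsomorphic 𝒜 ℬ) (h' : GradedIsomorphic ℬ 𝒞) :
    GradedIsomorphic 𝒜 𝒞 := by
  obtain ⟨h𝒜, -, φ, hφ, hφm⟩ := h
  obtain ⟨-, h𝒞, ψ, hψ, hψm⟩ := h'
  refine ⟨h𝒜, h𝒞, φ.trans ψ, fun x y => ?_, fun g => ?_⟩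
  · rw [LinearEquiv.trans_apply, hφ, hψ]
    rfl
  · rw [← hψm, ← hφm, ← Submodule.map_comp]
    rfl

end Graded

/-! ### The grading of a Steinberg algebra -/

namespace SteinbergAlgebra
variable {R Γ : Type*} [CommRing R] [TopologicalSpace Γ] [T2Space Γ] [ArrowGroupoid Γ]
  [AmpleGroupoid Γ]

@[ext]
theorem ext {f g : SteinbergAlgebra R Γ} (h : ∀ x, f x = g x) : f = g := DFunLike.ext _ _ h

theorem add_apply (f g : SteinbergAlgebra R Γ) (x : Γ) : (f + g) x = f x + g x := rfl
theorem smul_apply (r : R) (f : SteinbergAlgebra R Γ) (x : Γ) : (r • f) x = r * f x := rfl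
theorem mul_apply (f g : SteinbergAlgebra R Γ) (x : Γ) : (f * g) x = convolution f g x := rfl

theorem sum_apply {ι : Type*} (s : Finset ι) (f : ι → SteinbergAlgebra R Γ) (x : Γ) :
    (∑ i ∈ s, f i) x = ∑ i ∈ s, f i x :=
  map_sum (⟨⟨fun f : SteinbergAlgebra R Γ => f x, rfl⟩, fun _ _ => rfl⟩ :
    SteinbergAlgebra R Γ →+ R) f s

/-- The element of the Steinberg algebra that agrees with `f` on the clopen set `S` and vanishes
elsewhere. -/
noncomputable def indicator {S : Set Γ} (hS : IsClopen S) (f : SteinbergAlgebra R Γ) :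
    SteinbergAlgebra R Γ := CcR.indicator hS f

theorem indicator_apply {S : Set Γ} (hS : IsClopen S) (f : SteinbergAlgebra R Γ) (x : Γ) :
    indicator hS f x = S.indicator f x := rfl

theorem indicator_add_compl {S : Set Γ} (hS : IsClopen S) (f : SteinbergAlgebra R Γ) :
    indicator hS f + indicator hS.compl f = f :=
  CcR.indicator_add_compl hS f

/-- The functions that vanish on the set `S`. -/
def vanishing (R : Type*) [CommRing R] (S : Set Γ) : Submodule R (SteinbergAlgebra R Γ) where
  carrier := {f | ∀ x ∈ S, f x = 0}
  zero_mem' _ _ := rfl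
  add_mem' {f f'} hf hf' x hx := by rw [add_apply, hf x hx, hf' x hx, add_zero]
  smul_mem' r f hf x hx := by rw [smul_apply, hf x hx, mul_zero]

theorem exists_of_mul_apply_ne_zero {f g : SteinbergAlgebra R Γ} {x : Γ} (h : (f * g) x ≠ 0) :
    ∃ a b, ∃ e : dom a = rng b, comp a b e = x ∧ f a ≠ 0 ∧ g b ≠ 0 := by
  contrapose! h
  refine finsum_eq_zero_of_forall_eq_zero ?_
  rintro ⟨⟨a, b⟩, e, he⟩
  by_contra hp
  exact right_ne_zero_of_mul hp (h a b e he (left_ne_zero_of_mul hp))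

variable {G : Type*} [Group G]

theorem isAlgebraGrading_component (c : Cocycle Γ G) : IsAlgebraGrading (component R c) := by
  classical
  rw [isAlgebraGrading_iff]
  refine ⟨⟨fun g => ?_, ?_⟩, ?_⟩
  · rw [Submodule.disjoint_def]
    intro f hf hf'
    have hle : ⨆ (h) (_ : h ≠ g), component R c h ≤ vanishing R {x | c.deg x = g} := by
      refine iSup₂_le fun h hh f hf x hx => ?_
      by_contra hne
      exact hh ((hf x hne).symm.trans hx)
    ext x
    by_contra hne
    exact hne (hle hf' x (hf x hne))
  · rw [eq_top_iff]
    rintro f -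
    -- by local constancy, the degree takes only finitely many values on the compact support
    have hfin : (c.deg '' Function.support f.1).Finite := by
      let : TopologicalSpace G := ⊥
      have : DiscreteTopology G := ⟨rfl⟩
      exact (f.2.2.image c.isLocallyConstant.continuous).finite_of_discrete
    have hsum : f = ∑ g ∈ hfin.toFinset,
        indicator (c.isLocallyConstant.isClopen_fiber g) f := by
      ext x
      rw [sum_apply]
      by_cases hx : f x = 0
      · rw [hx]
        refine (Finset.sum_eq_zero fun g _ => ?_).symm
        exact Set.indicator_apply_eq_zero.2 fun _ => hx
      · rw [Finset.sum_eq_single (c.deg x)]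
        · exact (Set.indicator_of_mem (s := {y | c.deg y = c.deg x}) rfl f.1).symm
        · intro g _ hg
          exact Set.indicator_of_notMem (s := {y | c.deg y = g}) (fun h => hg h.symm) f.1
        · intro h
          exact absurd (hfin.mem_toFinset.2 ⟨x, hx, rfl⟩) h
    rw [hsum]
    refine Submodule.sum_mem _ fun g _ => Submodule.mem_iSup_of_mem g fun x hx => ?_
    exact Set.mem_of_indicator_ne_zero (s := {y | c.deg y = g}) hx
  · intro g h f hf f' hf' x hx
    obtain ⟨a, b, e, rfl, ha, hb⟩ := exists_of_mul_apply_ne_zero hx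
    rw [c.deg_comp, hf a ha, hf' b hb]

/-- A homeomorphism that is an isomorphism of groupoids and preserves degrees induces a graded
isomorphism of Steinberg algebras. -/
theorem gradedIsomorphic_of_homeomorph {Γ' : Type*} [TopologicalSpace Γ'] [T2Space Γ']
    [ArrowGroupoid Γ'] [AmpleGroupoid Γ'] (e : Γ' ≃ₜ Γ) (hd : ∀ x, e (dom x) = dom (e x))
    (hr : ∀ x, e (rng x) = rng (e x))
    (hc : ∀ x y h, e (comp x y h) = comp (e x) (e y) (by rw [← hd, ← hr, h]))
    (c : Cocycle Γ G) (c' : Cocycle Γ' G) (hdeg : ∀ x, c'.deg x = c.deg (e x)) :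
    GradedIsomorphic (component R c) (component R c') := by
  let φ : SteinbergAlgebra R Γ ≃ₗ[R] SteinbergAlgebra R Γ' :=
    { toFun := fun f => ⟨f.1 ∘ e, ⟨f.2.1.comp_continuous e.continuous, by
        rw [Function.support_comp_eq_preimage]
        exact e.isCompact_preimage.2 f.2.2⟩⟩
      invFun := fun f => ⟨f.1 ∘ e.symm, ⟨f.2.1.comp_continuous e.symm.continuous, by
        rw [Function.support_comp_eq_preimage]
        exact e.symm.isCompact_preimage.2 f.2.2⟩⟩
      map_add' := fun _ _ => rfl
      map_smul' := fun _ _ => rfl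
      left_inv := fun f => Subtype.ext (funext fun x => congrArg f.1 (e.apply_symm_apply x))
      right_inv := fun f => Subtype.ext (funext fun x => congrArg f.1 (e.symm_apply_apply x)) }
  have hφ : ∀ f x, φ f x = f (e x) := fun _ _ => rfl
  have hc' : ∀ x y h, e.symm (comp x y h) = comp (e.symm x) (e.symm y)
      (e.injective (by simpa [hd, hr] using h)) := by
    intro x y h
    apply e.injective
    rw [hc, e.apply_symm_apply]
    exact comp_congr (e.apply_symm_apply x).symm (e.apply_symm_apply y).symm h
  refine GradedIsomorphic.of_linearEquiv (isAlgebraGrading_component c) φ (fun f f' => ?_)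
    fun g => ?_
  · ext x
    rw [hφ, mul_apply, mul_apply, convolution, convolution]
    refine (finsum_eq_of_bijective
      (fun p : {p : Γ' × Γ' // ∃ h : dom p.1 = rng p.2, comp p.1 p.2 h = x} =>
        (⟨(e p.1.1, e p.1.2), by rw [← hd, ← hr, p.2.fst], by rw [← hc _ _ p.2.fst, p.2.snd]⟩ :
          {p : Γ × Γ // ∃ h : dom p.1 = rng p.2, comp p.1 p.2 h = e x})) ⟨?_, ?_⟩
      fun _ => rfl).symm
    · intro p q h
      exact factorization_ext (e.injective (congrArg (fun p => p.1.1) h))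
    · rintro ⟨⟨a, b⟩, h, he⟩
      refine ⟨⟨(e.symm a, e.symm b), e.injective (by simpa [hd, hr] using h), ?_⟩,
        factorization_ext (e.apply_symm_apply a)⟩
      dsimp only at h he ⊢
      rw [← hc' a b h, he, e.symm_apply_apply]
  · refine le_antisymm ?_ fun f hf => ⟨φ.symm f, fun x hx => ?_, φ.apply_symm_apply f⟩
    · rintro _ ⟨f, hf, rfl⟩ x hx
      rw [hdeg]
      exact hf _ hx
    · have := hf (e.symm x) hx
      rwa [hdeg, e.apply_symm_apply] at this

end SteinbergAlgebra

/-! ### Generators and relations of a partial skew inverse semigroup ring -/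

namespace AlgebraPartialAction
variable {R S A : Type*} [CommRing R] [InverseSemigroup S] [NonUnitalRing A] [Module R A]
  [IsScalarTower R A A] [SMulCommClass R A A] (π : AlgebraPartialAction R S A)

open FormalSums

theorem FormalSums.induction {p : FormalSums π → Prop} (x : FormalSums π) (h0 : p 0)
    (hδ : ∀ s a, p (delta π s a)) (hadd : ∀ x y, p x → p y → p (x + y)) : p x := by
  classical
  exact DirectSum.induction_on x h0 (fun s a => hδ s a) hadd

namespace SkewRing

theorem mk_delta_eq_of_natLE {s t : S} (h : NatLE s t) {a : A} (ha : a ∈ π.ideal s)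
    (ha' : a ∈ π.ideal t) : mk π (delta π s ⟨a, ha⟩) = mk π (delta π t ⟨a, ha'⟩) := by
  rw [← sub_eq_zero, ← map_sub]
  refine (Submodule.Quotient.mk_eq_zero _).2 (Submodule.mem_sInf.2 fun N hN => hN.1 ?_)
  exact ⟨s, t, h, ⟨a, ha⟩, rfl⟩

theorem mk_surjective : Function.Surjective (mk π) := (relIdeal π).mkQ_surjective

variable {π} in
/-- The linear map on `A ⋊_π S` induced by a multiplicative linear map that respects the relations
`a δ_s = a δ_t`, `s ≤ t`: the kernel is a two-sided ideal, so it contains the ideal generated by the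
relations. -/
noncomputable def lift {B : Type*} [NonUnitalNonAssocRing B] [Module R B] (F : FormalSums π →ₗ[R] B)
    (hmul : ∀ x y, F (x * y) = F x * F y) (hrel : ∀ x ∈ relations π, F x = 0) :
    SkewRing π →ₗ[R] B :=
  (relIdeal π).liftQ F (sInf_le ⟨hrel, fun x y hy => by
    rw [LinearMap.mem_ker] at hy
    simp only [LinearMap.mem_ker, hmul, hy, mul_zero, zero_mul, and_self]⟩)

theorem iSup_component {G : Type*} [Group G] (w : SemigroupGrading S G) :
    ⨆ g, component π w g = ⊤ := by
  rw [eq_top_iff]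
  rintro x -
  obtain ⟨x, rfl⟩ := mk_surjective π x
  induction x using FormalSums.induction with
  | h0 => rw [map_zero]; exact Submodule.zero_mem _
  | hadd x y hx hy => rw [_root_.map_add]; exact Submodule.add_mem _ hx hy
  | hδ s a =>
    by_cases hs : IsZeroElement s
    · -- the ideal attached to a zero element is zero
      have ha : a = 0 := by
        apply Subtype.ext
        have := a.2
        change a.1 ∈ π.carrier s at this
        rwa [π.carrier_zero s hs] at this
      rw [ha, map_zero, map_zero]
      exact Submodule.zero_mem _
    · exact Submodule.mem_iSup_of_mem (w.deg s) (Submodule.subset_span ⟨s, hs, rfl, a, rfl⟩)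

end SkewRing
end AlgebraPartialAction

/-! ### Intersections of graded bisections -/

namespace GradedBisection

theorem exists_mem {Γ G : Type*} [TopologicalSpace Γ] [ArrowGroupoid Γ]
    [Group G] [AmpleGroupoid Γ] (c : Cocycle Γ G) (x : Γ) :
    ∃ B : GradedBisection c, x ∈ B.carrier := by
  obtain ⟨B, ⟨hBc, hB⟩, hxB, hBS⟩ := AmpleGroupoid.isBasis.exists_subset_of_mem_open
    (show x ∈ {y | c.deg y = c.deg x} from rfl) (c.isLocallyConstant.isOpen_fiber _)
  exact ⟨⟨B, hBc, hB, c.deg x, hBS⟩, hxB⟩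

variable {Γ G : Type*} [TopologicalSpace Γ] [ArrowGroupoid Γ] [Group G] [T2Space Γ]
  [EtaleGroupoid Γ] {c : Cocycle Γ G}

/-- The intersection of two graded compact open bisections. -/
def inter (B C : GradedBisection c) : GradedBisection c where
  carrier := B.carrier ∩ C.carrier
  isCompact := B.isCompact.inter C.isCompact
  isBisection := isOpenBisection_iff.2 ⟨B.isBisection.isOpen.inter C.isBisection.isOpen,
    B.dom_inj.mono inter_subset_left, B.rng_inj.mono inter_subset_left⟩
  graded := let ⟨g, hg⟩ := B.graded; ⟨g, fun x hx => hg x hx.1⟩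

theorem natLE_of_subset {B C : GradedBisection c} (h : B.carrier ⊆ C.carrier) : NatLE B C := by
  ext x
  constructor
  · intro hx
    exact ⟨_, ⟨x, h hx, _, ⟨x, hx, rfl⟩, by simp, rfl⟩, x, hx, by simp, by
      rw [comp_congr (comp_inv x) rfl, comp_rng]⟩
  · rintro ⟨_, ⟨b, hb, _, ⟨b', hb', rfl⟩, h1, rfl⟩, b'', hb'', h2, rfl⟩
    have e : b = b' := C.dom_inj hb (h hb') (by simpa using h1)
    subst e
    have e' : b = b'' := B.rng_inj hb' hb'' (by simpa using h2)
    subst e'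
    rwa [comp_congr (comp_inv b) rfl, comp_rng]

end GradedBisection

/-! ### The homomorphism from the skew ring to the Steinberg algebra -/

namespace OpenInvariant
section
variable {Γ G : Type*} [TopologicalSpace Γ] [ArrowGroupoid Γ] (U : OpenInvariant Γ)

/-- The range map `𝒢_U → U`. -/
def rngRestriction (x : U.Restriction) : U.carrier := ⟨rng x.1, U.invariant _ x.2⟩

theorem continuous_rngRestriction [EtaleGroupoid Γ] : Continuous U.rngRestriction :=
  (continuous_rng.comp continuous_subtype_val).subtype_mk _

theorem isClopen_preimage_bisection [Group G] [T2Space Γ] [EtaleGroupoid Γ]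
    {c : Cocycle Γ G} (B : GradedBisection c) :
    IsClopen (Subtype.val ⁻¹' B.carrier : Set U.Restriction) :=
  ⟨B.isCompact.isClosed.preimage continuous_subtype_val,
    B.isBisection.isOpen.preimage continuous_subtype_val⟩

end

variable {Γ G R : Type*} [TopologicalSpace Γ] [ArrowGroupoid Γ] [Group G] [T2Space Γ]
  [AmpleGroupoid Γ] [CommRing R] {c : Cocycle Γ G} (U : OpenInvariant Γ)

/-- The function on `𝒢_U` that is supported in `B` and takes the value `a(r(b))` at `b ∈ B`. The
values of `a` outside `r(B)` play no role. -/
noncomputable def bisectionFun (B : GradedBisection c) (a : CcR R U.carrier) :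
    SteinbergAlgebra R U.Restriction :=
  ⟨(Subtype.val ⁻¹' B.carrier : Set U.Restriction).indicator (a.1 ∘ U.rngRestriction), by
    have hl := (a.2.1.comp_continuous U.continuous_rngRestriction).indicator
      (U.isClopen_preimage_bisection B)
    have h1 : IsCompact (Subtype.val '' Function.support a.1 : Set Γ) :=
      a.2.2.image continuous_subtype_val
    have h2 : IsCompact (B.carrier ∩ rng ⁻¹' (Subtype.val '' Function.support a.1)) :=
      B.isCompact.inter_right (h1.isClosed.preimage continuous_rng)
    refine ⟨hl, (U.isOpenEmbedding_val.isInducing.isCompact_preimage' h2 ?_).of_isClosed_subset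
      hl.isClosed_support ?_⟩
    · rintro x ⟨-, u, -, hu⟩
      exact ⟨⟨x, U.invariant' (by rw [← hu]; exact u.2)⟩, rfl⟩
    · intro x hx
      rw [Set.support_indicator] at hx
      exact ⟨hx.1, _, hx.2, rfl⟩⟩

theorem bisectionFun_of_mem {B : GradedBisection c} (a : CcR R U.carrier) {x : U.Restriction}
    (hx : x.1 ∈ B.carrier) : U.bisectionFun B a x = a.1 (U.rngRestriction x) :=
  Set.indicator_of_mem (s := (Subtype.val ⁻¹' B.carrier : Set U.Restriction)) hx _

theorem bisectionFun_of_notMem {B : GradedBisection c} (a : CcR R U.carrier) {x : U.Restriction}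
    (hx : x.1 ∉ B.carrier) : U.bisectionFun B a x = 0 :=
  Set.indicator_of_notMem (s := (Subtype.val ⁻¹' B.carrier : Set U.Restriction)) hx _

theorem bisectionFun_add (B : GradedBisection c) (a a' : CcR R U.carrier) :
    U.bisectionFun B (a + a') = U.bisectionFun B a + U.bisectionFun B a' :=
  Subtype.ext (Set.indicator_add _ _ _)

theorem bisectionFun_smul (B : GradedBisection c) (r : R) (a : CcR R U.carrier) :
    U.bisectionFun B (r • a) = r • U.bisectionFun B a :=
  Subtype.ext (Set.indicator_const_smul (Subtype.val ⁻¹' B.carrier) r (a.1 ∘ U.rngRestriction))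

theorem bisectionFun_mul (B C : GradedBisection c) (a b : CcR R U.carrier) :
    U.bisectionFun (B * C) (U.functionMap R B (U.functionMap R B⁻¹ a * b)) =
      U.bisectionFun B a * U.bisectionFun C b := by
  ext x
  by_cases h : ∃ β : U.Restriction, β.1 ∈ B.carrier ∧ rng β = rng x
  · -- only the factorization of `x` that starts with the arrow of `B` at `r(x)` contributes
    obtain ⟨β, hβ, hr⟩ := h
    have hβx : comp β (comp (inv β) x (by simpa using hr)) (by simp) = x := comp_inv_cancel hr
    set κ := comp (inv β) x (by simpa using hr) with hκ
    have hd : dom β = rng κ := by simp [hκ]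
    have hRHS : (U.bisectionFun B a * U.bisectionFun C b) x =
        a.1 (U.rngRestriction β) * U.bisectionFun C b κ := by
      rw [SteinbergAlgebra.mul_apply, convolution, finsum_eq_single _ ⟨(β, κ), hd, hβx⟩]
      · dsimp only
        rw [U.bisectionFun_of_mem a hβ]
      · rintro ⟨⟨α, κ'⟩, e, he⟩ hne
        dsimp only at e he ⊢
        have hα : α.1 ∉ B.carrier := fun hα => hne (factorization_ext (Subtype.ext
          (B.rng_inj hα hβ (congrArg Subtype.val (show rng α = rng β by rw [hr, ← he, rng_comp])))))
        rw [U.bisectionFun_of_notMem a hα, zero_mul]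
    have hrx : rng β.1 = rng x.1 := congrArg Subtype.val hr
    rw [hRHS]
    by_cases hC : κ.1 ∈ C.carrier
    · have hx : x.1 ∈ (B * C).carrier :=
        ⟨β.1, hβ, κ.1, hC, congrArg Subtype.val hd, congrArg Subtype.val hβx⟩
      rw [U.bisectionFun_of_mem _ hx, U.bisectionFun_of_mem b hC,
        U.functionMap_of_mem B _ (⟨β.1, hβ, hrx⟩ : U.rngRestriction x ∈ U.unitCarrier B)]
      have e1 : U.unitMap B⁻¹ (U.rngRestriction x) = U.rngRestriction κ := Subtype.ext (by
        rw [U.unitMap_eq B⁻¹ ⟨β.1, hβ, rfl⟩ _ ((dom_inv _).trans hrx), rng_inv]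
        exact congrArg Subtype.val hd)
      have hd' : dom β.1 = rng κ.1 := congrArg Subtype.val hd
      have e2 : U.unitMap B⁻¹⁻¹ (U.rngRestriction κ) = U.rngRestriction β := Subtype.ext (by
        rw [InverseSemigroup.inv_inv, U.unitMap_eq B hβ _ hd']
        rfl)
      have h2 : U.rngRestriction κ ∈ U.unitCarrier B⁻¹ :=
        (U.mem_unitCarrier_inv B).2 ⟨β.1, hβ, hd'⟩
      rw [e1]
      change (U.functionMap R B⁻¹ a).1 _ * b.1 _ = _
      rw [U.functionMap_of_mem B⁻¹ a h2, e2]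
    · rw [U.bisectionFun_of_notMem b hC, mul_zero, U.bisectionFun_of_notMem]
      rintro ⟨β', hβ', d, hd', e, hx⟩
      have hbb : β' = β.1 := B.rng_inj hβ' hβ (by rw [hrx, ← hx, rng_comp])
      subst hbb
      have hdκ : d = κ.1 := by
        rw [← inv_comp_cancel e]
        exact comp_congr rfl hx _
      exact hC (hdκ ▸ hd')
  · rw [U.bisectionFun_of_notMem]
    · by_contra hne
      obtain ⟨α, κ, e, he, hα, -⟩ := SteinbergAlgebra.exists_of_mul_apply_ne_zero (Ne.symm hne)
      exact h ⟨α, by_contra fun hB => hα (U.bisectionFun_of_notMem a hB), by rw [← he, rng_comp]⟩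
    · rintro ⟨β, hβ, d, -, e, hx⟩
      have hr : rng β = rng x.1 := by rw [← hx, rng_comp]
      exact h ⟨⟨β, U.invariant' (by rw [hr]; exact U.invariant _ x.2)⟩, hβ, Subtype.ext hr⟩

open AlgebraPartialAction

variable (c R) in
/-- The linear map `∑ a_B δ_B ↦ ∑ a_B ∘ r|_B` from formal sums to functions on `𝒢_U`. -/
noncomputable def toSteinberg : FormalSums (U.functionAction c R) →ₗ[R]
    SteinbergAlgebra R U.Restriction := by
  classical
  exact DirectSum.toModule R (GradedBisection c) _ fun B =>
    { toFun := fun a => U.bisectionFun B a.1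
      map_add' := fun a a' => U.bisectionFun_add B a.1 a'.1
      map_smul' := fun r a => U.bisectionFun_smul B r a.1 }

theorem toSteinberg_delta (B : GradedBisection c) (a : (U.functionAction c R).ideal B) :
    U.toSteinberg R c (FormalSums.delta _ B a) = U.bisectionFun B a.1 := by
  classical
  exact DirectSum.toModule_lof (M := fun B => (U.functionAction c R).ideal B) R B a

theorem toSteinberg_mul (x y : FormalSums (U.functionAction c R)) :
    U.toSteinberg R c (x * y) = U.toSteinberg R c x * U.toSteinberg R c y := by
  induction x using FormalSums.induction with
  | h0 => rw [zero_mul, map_zero, zero_mul]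
  | hadd x x' hx hx' => rw [add_mul, _root_.map_add, _root_.map_add, hx, hx', add_mul]
  | hδ B a =>
    induction y using FormalSums.induction with
    | h0 => rw [mul_zero, map_zero, mul_zero]
    | hadd y y' hy hy' => rw [mul_add, _root_.map_add, _root_.map_add, hy, hy', mul_add]
    | hδ C b =>
      rw [FormalSums.delta_mul_delta, toSteinberg_delta, toSteinberg_delta, toSteinberg_delta]
      exact U.bisectionFun_mul B C a.1 b.1

theorem toSteinberg_relations (x : FormalSums (U.functionAction c R))
    (hx : x ∈ FormalSums.relations (U.functionAction c R)) : U.toSteinberg R c x = 0 := by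
  obtain ⟨B, C, h, a, rfl⟩ := hx
  have hBC := GradedBisection.subset_of_natLE h
  rw [map_sub, toSteinberg_delta, toSteinberg_delta, sub_eq_zero]
  ext x
  by_cases hB : x.1 ∈ B.carrier
  · rw [U.bisectionFun_of_mem _ hB, U.bisectionFun_of_mem _ (hBC hB)]
  · rw [U.bisectionFun_of_notMem _ hB]
    by_cases hC : x.1 ∈ C.carrier
    · rw [U.bisectionFun_of_mem _ hC]
      refine (a.2 _ ?_).symm
      rintro ⟨b, hb, e⟩
      exact hB (C.rng_inj (hBC hb) hC e ▸ hb)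
    · rw [U.bisectionFun_of_notMem _ hC]

variable (c R) in
/-- The homomorphism `C_R(U) ⋊_π 𝒢^(h) → A_R(𝒢_U)` that sends the class of `a δ_B` to the function
`a ∘ r` on `B`, extended by zero. -/
noncomputable def skewToSteinberg : SkewRing (U.functionAction c R) →ₗ[R]
    SteinbergAlgebra R U.Restriction :=
  SkewRing.lift (U.toSteinberg R c) U.toSteinberg_mul U.toSteinberg_relations

theorem skewToSteinberg_mk_delta (B : GradedBisection c) (a : (U.functionAction c R).ideal B) :
    U.skewToSteinberg R c (SkewRing.mk _ (FormalSums.delta _ B a)) = U.bisectionFun B a.1 :=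
  U.toSteinberg_delta B a

theorem skewToSteinberg_mul (x y : SkewRing (U.functionAction c R)) :
    U.skewToSteinberg R c (x * y) = U.skewToSteinberg R c x * U.skewToSteinberg R c y := by
  obtain ⟨x, rfl⟩ := SkewRing.mk_surjective _ x
  obtain ⟨y, rfl⟩ := SkewRing.mk_surjective _ y
  exact U.toSteinberg_mul x y

/-! ### Injectivity -/

variable (R) in
/-- The classes of the elements `a δ_B` for a fixed `B`. -/
noncomputable def bisectionClasses (B : GradedBisection c) :
    Submodule R (SkewRing (U.functionAction c R)) :=
  LinearMap.range (SkewRing.mk _ ∘ₗ FormalSums.delta (U.functionAction c R) B)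

/-- A class `a δ_B` whose function is supported in a finite union of bisections `C` is a sum of
classes `a_C δ_C`: cutting `a` down to `r(B ∩ C)` gives an element on which
`a δ_B = a δ_{B ∩ C} = a δ_C`, and the rest of `a` is supported in the remaining bisections. -/
theorem mk_delta_mem_iSup_of_support_subset (t : Finset (GradedBisection c)) (B : GradedBisection c)
    (a : (U.functionAction c R).ideal B)
    (h : ∀ x, U.bisectionFun B a.1 x ≠ 0 → ∃ C ∈ t, x.1 ∈ C.carrier) :
    SkewRing.mk _ (FormalSums.delta _ B a) ∈ ⨆ C ∈ t, U.bisectionClasses R C := by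
  classical
  induction t using Finset.induction_on generalizing a with
  | empty =>
    have ha : a = 0 := by
      refine Subtype.ext (Subtype.ext (funext fun u => ?_))
      by_contra hu
      obtain ⟨b, hb, hbu⟩ : u ∈ U.unitCarrier B := by_contra fun h => hu (a.2 u h)
      have hb' : rng b ∈ U.carrier := by rw [hbu]; exact u.2
      obtain ⟨C, hC, -⟩ := h ⟨b, U.invariant' hb'⟩ (by
        rw [U.bisectionFun_of_mem _ hb]
        exact (congrArg a.1.1 (Subtype.ext hbu)).trans_ne hu)
      simp at hC
    rw [ha, map_zero, map_zero]
    exact Submodule.zero_mem _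
  | insert C t hCt ih =>
    have hcl := U.isClopen_unitCarrier (B.inter C)
    have hmem1 : CcR.indicator hcl a.1 ∈ (U.functionAction c R).ideal (B.inter C) :=
      fun u hu => Set.indicator_of_notMem hu _
    have hB1 : CcR.indicator hcl a.1 ∈ (U.functionAction c R).ideal B := fun u hu =>
      hmem1 u fun ⟨b, hb, e⟩ => hu ⟨b, hb.1, e⟩
    have hC1 : CcR.indicator hcl a.1 ∈ (U.functionAction c R).ideal C := fun u hu =>
      hmem1 u fun ⟨b, hb, e⟩ => hu ⟨b, hb.2, e⟩
    have hB2 : CcR.indicator hcl.compl a.1 ∈ (U.functionAction c R).ideal B := fun u hu =>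
      Set.indicator_apply_eq_zero.2 fun _ => a.2 u hu
    have hsplit : a = ⟨_, hB1⟩ + ⟨_, hB2⟩ := Subtype.ext (CcR.indicator_add_compl hcl a.1).symm
    rw [hsplit, _root_.map_add, _root_.map_add, Finset.iSup_insert]
    refine Submodule.add_mem_sup ?_ (ih _ fun x hx => ?_)
    · rw [← SkewRing.mk_delta_eq_of_natLE (U.functionAction c R)
        (GradedBisection.natLE_of_subset (B := B.inter C) inter_subset_left) hmem1 hB1,
        SkewRing.mk_delta_eq_of_natLE (U.functionAction c R)
        (GradedBisection.natLE_of_subset (B := B.inter C) inter_subset_right) hmem1 hC1]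
      exact ⟨_, rfl⟩
    · have hxB : x.1 ∈ B.carrier := by_contra fun h => hx (U.bisectionFun_of_notMem _ h)
      rw [U.bisectionFun_of_mem _ hxB] at hx
      have hx1 : U.rngRestriction x ∉ U.unitCarrier (B.inter C) :=
        Set.mem_of_indicator_ne_zero (s := (U.unitCarrier (B.inter C))ᶜ) hx
      have hx2 : a.1.1 (U.rngRestriction x) ≠ 0 := fun h0 =>
        hx (Set.indicator_apply_eq_zero.2 fun _ => h0)
      obtain ⟨D, hD, hxD⟩ := h x (by rwa [U.bisectionFun_of_mem _ hxB])
      rcases Finset.mem_insert.1 hD with rfl | hD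
      · exact absurd ⟨x.1, ⟨hxB, hxD⟩, rfl⟩ hx1
      · exact ⟨D, hD, hxD⟩

theorem exists_mem_of_skewToSteinberg_ne_zero {t : Finset (GradedBisection c)}
    {y : SkewRing (U.functionAction c R)} (hy : y ∈ ⨆ C ∈ t, U.bisectionClasses R C)
    {x : U.Restriction} (hx : U.skewToSteinberg R c y x ≠ 0) : ∃ C ∈ t, x.1 ∈ C.carrier := by
  by_contra! h
  have hle : ⨆ C ∈ t, U.bisectionClasses R C ≤
      (SteinbergAlgebra.vanishing R {x}).comap (U.skewToSteinberg R c) := by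
    refine iSup₂_le fun C hC => ?_
    rintro _ ⟨a, rfl⟩ _ rfl
    exact (congrArg (fun f : SteinbergAlgebra R U.Restriction => f _)
      (U.skewToSteinberg_mk_delta C a)).trans (U.bisectionFun_of_notMem _ (h C hC))
  exact hx (hle hy x rfl)

/-- Induction on the number of bisections: when the image of a sum of classes vanishes, the term of
one bisection can be rewritten as a sum of classes of the others. -/
theorem eq_zero_of_mem_iSup (t : Finset (GradedBisection c))
    {y : SkewRing (U.functionAction c R)} (hy : y ∈ ⨆ C ∈ t, U.bisectionClasses R C)
    (h0 : U.skewToSteinberg R c y = 0) : y = 0 := by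
  classical
  induction t using Finset.induction_on with
  | empty => simpa using hy
  | insert B t hBt ih =>
    apply ih
    rw [Finset.iSup_insert] at hy
    obtain ⟨_, ⟨a, rfl⟩, z, hz, rfl⟩ := Submodule.mem_sup.1 hy
    refine Submodule.add_mem _ (U.mk_delta_mem_iSup_of_support_subset t B a fun x hx => ?_) hz
    -- the function of `a δ_B` is minus that of `z`, so it is supported in the bisections of `t`
    refine U.exists_mem_of_skewToSteinberg_ne_zero hz (x := x) fun hzx => hx ?_
    rw [_root_.map_add] at h0
    have h1 := congrArg (fun f : SteinbergAlgebra R U.Restriction => f x) h0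
    have h2 := U.skewToSteinberg_mk_delta B a
    rw [← h2]
    rw [SteinbergAlgebra.add_apply, hzx, add_zero] at h1
    exact h1

theorem exists_mem_iSup (y : SkewRing (U.functionAction c R)) :
    ∃ t : Finset (GradedBisection c), y ∈ ⨆ C ∈ t, U.bisectionClasses R C := by
  classical
  obtain ⟨y, rfl⟩ := SkewRing.mk_surjective _ y
  induction y using FormalSums.induction with
  | h0 => exact ⟨∅, by rw [map_zero]; exact Submodule.zero_mem _⟩
  | hδ B a => exact ⟨{B}, by simpa using ⟨a, rfl⟩⟩
  | hadd x y hx hy =>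
    obtain ⟨t, ht⟩ := hx
    obtain ⟨t', ht'⟩ := hy
    refine ⟨t ∪ t', ?_⟩
    rw [_root_.map_add, Finset.iSup_union]
    exact Submodule.add_mem_sup ht ht'

theorem skewToSteinberg_injective : Function.Injective (U.skewToSteinberg R c) := by
  rw [injective_iff_map_eq_zero]
  intro y hy
  obtain ⟨t, ht⟩ := U.exists_mem_iSup y
  exact U.eq_zero_of_mem_iSup t ht hy

/-! ### Surjectivity -/

/-- A function `f` supported in a graded bisection `B` is the image of `a δ_B` with `a = f ∘ σ`, where
`σ : r(B) → B` is the continuous section of `r`. -/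
theorem mem_range_skewToSteinberg_of_support_subset (B : GradedBisection c)
    (f : SteinbergAlgebra R U.Restriction) (hf : ∀ x, f x ≠ 0 → x.1 ∈ B.carrier) :
    f ∈ LinearMap.range (U.skewToSteinberg R c) := by
  classical
  obtain ⟨σ, hσ, hm, hr⟩ := B.isBisection.exists_section
  have hτ : Continuous (fun u : U.unitCarrier B => (⟨σ ⟨u.1.1, u.2⟩, U.invariant' (by
      rw [hr]; exact u.1.2)⟩ : U.Restriction)) :=
    (hσ.comp ((continuous_subtype_val.comp continuous_subtype_val).subtype_mk _)).subtype_mk _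
  have hl := IsLocallyConstant.dite_zero (U.isClopen_unitCarrier B) (f.2.1.comp_continuous hτ)
  have hsupp : IsCompact (U.rngRestriction '' Function.support f.1) :=
    f.2.2.image U.continuous_rngRestriction
  let a : CcR R U.carrier := ⟨_, hl, hsupp.of_isClosed_subset hl.isClosed_support (by
    intro u hu
    rw [Function.mem_support] at hu
    split_ifs at hu with h
    · exact ⟨_, hu, Subtype.ext (hr _)⟩
    · exact absurd rfl hu)⟩
  have ha : a ∈ (U.functionAction c R).ideal B := fun u hu => dif_neg hu
  refine ⟨SkewRing.mk _ (FormalSums.delta _ B ⟨a, ha⟩), ?_⟩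
  rw [skewToSteinberg_mk_delta]
  ext x
  by_cases hx : x.1 ∈ B.carrier
  · rw [U.bisectionFun_of_mem _ hx]
    have hu : U.rngRestriction x ∈ U.unitCarrier B := ⟨x.1, hx, rfl⟩
    refine (dif_pos hu).trans (congrArg f.1 (Subtype.ext ?_))
    exact B.rng_inj (hm _) hx (hr _)
  · rw [U.bisectionFun_of_notMem _ hx]
    by_contra h
    exact hx (hf x (Ne.symm h))

theorem skewToSteinberg_surjective : Function.Surjective (U.skewToSteinberg R c) := by
  classical
  rw [← LinearMap.range_eq_top, eq_top_iff]
  rintro f -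
  -- cover the support by finitely many graded bisections, then peel them off
  obtain ⟨t, ht⟩ := f.2.2.elim_finite_subcover
    (fun B : GradedBisection c => (Subtype.val ⁻¹' B.carrier : Set U.Restriction))
    (fun B => (U.isClopen_preimage_bisection B).isOpen)
    (fun x _ => mem_iUnion.2 (GradedBisection.exists_mem c x.1))
  replace ht : ∀ x, f x ≠ 0 → ∃ B ∈ t, x.1 ∈ B.carrier := fun x hx => by simpa using ht hx
  induction t using Finset.induction_on generalizing f with
  | empty =>
    have : f = 0 := by
      ext x
      by_contra hx
      simpa using ht x hx
    rw [this]
    exact Submodule.zero_mem _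
  | insert B t hBt ih =>
    have hB := U.isClopen_preimage_bisection B
    rw [← SteinbergAlgebra.indicator_add_compl hB f]
    refine Submodule.add_mem _ (U.mem_range_skewToSteinberg_of_support_subset B _ fun x hx => ?_)
      (ih fun x hx => ?_)
    · exact Set.mem_of_indicator_ne_zero (s := (Subtype.val ⁻¹' B.carrier : Set U.Restriction)) hx
    · rw [SteinbergAlgebra.indicator_apply] at hx
      have hxB : x.1 ∉ B.carrier := Set.mem_of_indicator_ne_zero hx
      have hfx : f x ≠ 0 := fun h => hx (Set.indicator_apply_eq_zero.2 fun _ => h)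
      obtain ⟨D, hD, hxD⟩ := ht x hfx
      rcases Finset.mem_insert.1 hD with rfl | hD
      · exact absurd hxD hxB
      · exact ⟨D, hD, hxD⟩

/-! ### The graded isomorphism -/

variable (c R) in
/-- The isomorphism `C_R(U) ⋊_π 𝒢^(h) ≃ A_R(𝒢_U)`. -/
noncomputable def skewEquivSteinberg : SkewRing (U.functionAction c R) ≃ₗ[R]
    SteinbergAlgebra R U.Restriction :=
  LinearEquiv.ofBijective (U.skewToSteinberg R c)
    ⟨U.skewToSteinberg_injective, U.skewToSteinberg_surjective⟩

theorem map_skewComponent_le (g : G) : (U.skewComponent c R g).map (U.skewToSteinberg R c) ≤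
    SteinbergAlgebra.component R (c.restrict U) g := by
  classical
  rw [skewComponent, SkewRing.component, Submodule.map_span_le]
  rintro _ ⟨B, -, rfl, a, rfl⟩ x hx
  rw [skewToSteinberg_mk_delta] at hx
  have hxB : x.1 ∈ B.carrier := by_contra fun h => hx (U.bisectionFun_of_notMem _ h)
  have hB : B.carrier.Nonempty := ⟨_, hxB⟩
  obtain ⟨g, hg⟩ := B.graded
  change c.deg x.1 = if h : B.carrier.Nonempty then c.deg h.some else 1
  rw [dif_pos hB, hg _ hxB, hg _ hB.some_mem]

/-- The images of the components of the skew ring lie in the components of the Steinberg algebra and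
span it; as the latter components are independent, the inclusions are equalities. -/
theorem map_skewComponent (g : G) : (U.skewComponent c R g).map (U.skewToSteinberg R c) =
    SteinbergAlgebra.component R (c.restrict U) g := by
  refine iSupIndep.eq_of_le_of_iSup_eq_top
    (isAlgebraGrading_iff.1 (SteinbergAlgebra.isAlgebraGrading_component (c.restrict U))).1.1
    U.map_skewComponent_le ?_ g
  have h : ⨆ g, U.skewComponent c R g = ⊤ := SkewRing.iSup_component _ _
  rw [← Submodule.map_iSup, h, Submodule.map_top, LinearMap.range_eq_top]
  exact U.skewToSteinberg_surjective

theorem gradedIsomorphic_skewRing : GradedIsomorphic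
    (A := SteinbergAlgebra R U.Restriction)
    (B := SkewRing (U.functionAction c R))
    (SteinbergAlgebra.component R (c.restrict U)) (U.skewComponent c R) := by
  have happly : ∀ y, U.skewEquivSteinberg R c y = U.skewToSteinberg R c y := fun _ => rfl
  refine GradedIsomorphic.of_linearEquiv (SteinbergAlgebra.isAlgebraGrading_component _)
    (U.skewEquivSteinberg R c).symm (fun x y => ?_) fun g => ?_
  · apply (U.skewEquivSteinberg R c).injective
    rw [happly ((U.skewEquivSteinberg R c).symm x * _), skewToSteinberg_mul, ← happly, ← happly]
    simp only [LinearEquiv.apply_symm_apply]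
  · rw [← U.map_skewComponent g]
    ext y
    constructor
    · rintro ⟨_, ⟨z, hz, rfl⟩, rfl⟩
      rw [← happly]
      simpa using hz
    · intro hy
      exact ⟨_, ⟨y, hy, rfl⟩, (U.skewEquivSteinberg R c).symm_apply_apply y⟩

/-- The restriction of a groupoid to its whole unit space is the groupoid itself. -/
theorem gradedIsomorphic_whole (c : Cocycle Γ G) : GradedIsomorphic
    (SteinbergAlgebra.component R c)
    (SteinbergAlgebra.component R (c.restrict (OpenInvariant.whole (Γ := Γ)))) :=
  SteinbergAlgebra.gradedIsomorphic_of_homeomorph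
    (Γ' := (OpenInvariant.whole (Γ := Γ)).Restriction)
    { toFun := Subtype.val
      invFun := fun x => ⟨x, dom_mem x⟩
      left_inv := fun _ => rfl
      right_inv := fun _ => rfl
      continuous_toFun := continuous_subtype_val
      continuous_invFun := continuous_id.subtype_mk _ }
    (fun _ => rfl) (fun _ => rfl) (fun _ _ _ => rfl) _ _ fun _ => rfl

end OpenInvariant

theorem mainTheorem1 {Γ G R : Type*} [TopologicalSpace Γ] [T2Space Γ] [ArrowGroupoid Γ]
    [AmpleGroupoid Γ] [Group G] [CommRing R] (c : Cocycle Γ G) :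
    (∀ U : OpenInvariant Γ,
      GradedIsomorphic
        (A := SteinbergAlgebra R U.Restriction)
        (B := AlgebraPartialAction.SkewRing (U.functionAction c R))
        (SteinbergAlgebra.component R (c.restrict U)) (U.skewComponent c R)) ∧
    GradedIsomorphic
      (A := SteinbergAlgebra R Γ)
      (B := AlgebraPartialAction.SkewRing ((OpenInvariant.whole (Γ := Γ)).functionAction c R))
      (SteinbergAlgebra.component R c) ((OpenInvariant.whole (Γ := Γ)).skewComponent c R) :=
  ⟨fun U => U.gradedIsomorphic_skewRing, (OpenInvariant.gradedIsomorphic_whole c).trans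
    (OpenInvariant.whole (Γ := Γ)).gradedIsomorphic_skewRing⟩
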